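/- Let $k$ be a field, $M$ a free abelian group of finite rank and $M_{\mathbb R}=M\otimes\mathbb R$. A *fan* $\Delta$ in $M_{\mathbb R}$ is a finite non-empty set of rational polyhedral cones (not necessarily strongly convex) that contains every face of each of its cones, and in which any two cones intersect in a common face. A *monoidal complex* $\mathcal M=(M,\Delta,(S_\sigma)_{\sigma\in\Delta})$ consists of such a fan and finitely generated submonoids $S_\sigma\subseteq M\cap\sigma$ generating the cone $\sigma$, with $S_\tau=S_\sigma\cap\tau$ for every face $\tau$ of $\sigma$. The *toric face ring* $k[\mathcal M]$ has $k$-basis $\chi^m$, $m\in\bigcup_{\sigma}S_\sigma$, with $\chi^m\chi^{m'}=\chi^{m+m'}$ if $m,m'$ lie in a common $S_\sigma$, and $\chi^m\chi^{m'}=0$ otherwise. Put $X=\operatorname{Spec}k[\mathcal M]$ and $\Lambda_\sigma=S_\sigma-S_\sigma$. The maximal cones of $\Delta$ are called *facets*, and the *codimension* of $\sigma\in\Delta$ is the maximum of $\dim\tau-\dim\sigma$ over the cones $\tau\in\Delta$ containing $\sigma$. The fan $\Delta$ is *$1$-connected* if for any two facets $F\ne F'$ there is a sequence of facets $F=F_0,F_1,\dots,F_n=F'$,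 all containing $F\cap F'$, such that $F_i\cap F_{i+1}$ has codimension one in both $F_i$ and $F_{i+1}$ for all $0\le i<n$. A Noetherian ring $A$, or $\operatorname{Spec}A$, is $S_2$ if $\operatorname{depth}A_{\mathfrak p}\ge\min(2,\dim A_{\mathfrak p})$ for every prime ideal $\mathfrak p$; and $A$, or $\operatorname{Spec}A$, is *seminormal* if for all $x,y\in A$ with $x^3=y^2$ there is a unique $a\in A$ with $x=a^2$, $y=a^3$. **Corollary.** Suppose $X$ is seminormal. Then $X$ is $S_2$ if and only if the following two properties hold: 1. $\Delta$ is $1$-connected; 2. for every $\sigma\in\Delta$ of positive codimension, $$\Lambda_\sigma=\bigcap_{\tau\in\Delta,\ \tau\supseteq\sigma,\ \operatorname{codim}\tau=1}\Lambda_\tau .$$ **Companion corollary** ($X$ not assumed seminormal). Suppose every irreducible component of $X$, with its reduced structure, is $S_2$. Then $X$ is $S_2$ if and only if $\Delta$ is $1$-connected. -/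

import Mathlib

open scoped TensorProduct

noncomputable section

/-- The canonical map `M → M_ℝ = ℝ ⊗ M` of a lattice into its real vector space. -/
def latticeMap (M : Type*) [AddCommGroup M] : M →+ ℝ ⊗[ℤ] M :=
  (TensorProduct.mk ℤ ℝ M 1).toAddMonoidHom

/-- A fan with respect to the lattice `M`: a finite (nonempty) collection of rational polyhedral
cones in `M_ℝ`, not necessarily strongly convex, closed under taking faces, such that any two
of its cones intersect in a common face. -/
structure RationalFan (M : Type*) [AddCommGroup M] where
  /-- the cones of the fan -/
  cones : Finset (PointedCone ℝ (ℝ ⊗[ℤ] M))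
  nonempty : cones.Nonempty
  rational : ∀ σ ∈ cones, ∃ s : Finset M, σ = PointedCone.hull ℝ (latticeMap M '' (s : Set M))
  face_mem : ∀ σ ∈ cones, ∀ τ : PointedCone ℝ (ℝ ⊗[ℤ] M), τ.IsFaceOf σ → τ ∈ cones
  inf_isFaceOf_left : ∀ σ ∈ cones, ∀ τ ∈ cones, (σ ⊓ τ).IsFaceOf σ
  inf_isFaceOf_right : ∀ σ ∈ cones, ∀ τ ∈ cones, (σ ⊓ τ).IsFaceOf τ

/-- The dimension of a cone: the dimension of its linear span. -/
def coneDim {M : Type*} [AddCommGroup M] (σ : PointedCone ℝ (ℝ ⊗[ℤ] M)) : ℕ :=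
  Module.finrank ℝ (Submodule.span ℝ (σ : Set (ℝ ⊗[ℤ] M)))

namespace RationalFan

variable {M : Type*} [AddCommGroup M] (Δ : RationalFan M)

/-- The type of cones of a fan, ordered by inclusion. -/
abbrev Cone : Type _ := {σ : PointedCone ℝ (ℝ ⊗[ℤ] M) // σ ∈ Δ.cones}

variable {Δ}

/-- The facets of a fan are its maximal cones. -/
def IsFacet (F : Δ.Cone) : Prop := IsMax F

/-- The codimension of a cone `σ` in the fan `Δ`: the largest value of `dim τ - dim σ` for cones
`τ ⊇ σ` of `Δ`. It is `0` exactly for the facets. -/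
def codim (σ : Δ.Cone) : ℕ∞ :=
  ⨆ τ : Δ.Cone, ⨆ _ : σ ≤ τ, ((coneDim τ.1 - coneDim σ.1 : ℕ) : ℕ∞)

variable (Δ)

/-- `1`-connectedness: any two distinct facets `F`, `F'` are joined by a sequence of facets
`F = F₀, …, Fₙ = F'` which contain `F ∩ F'`, such that `Fᵢ ∩ Fᵢ₊₁` has codimension one in both
`Fᵢ` and `Fᵢ₊₁`. -/
def IsOneConnected : Prop :=
  ∀ F F' : Δ.Cone, IsFacet F → IsFacet F' → F ≠ F' →
    ∃ (n : ℕ) (G : ℕ → Δ.Cone), G 0 = F ∧ G n = F' ∧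
      (∀ i ≤ n, IsFacet (G i) ∧ F.1 ⊓ F'.1 ≤ (G i).1) ∧
      ∀ i < n, coneDim ((G i).1 ⊓ (G (i + 1)).1) + 1 = coneDim (G i).1 ∧
        coneDim ((G i).1 ⊓ (G (i + 1)).1) + 1 = coneDim (G (i + 1)).1

end RationalFan

/-- A monoidal complex `(M, Δ, (S_σ)_{σ ∈ Δ})`: finitely generated semigroups (with `0`)
`S_σ ⊆ M ∩ σ` generating the cone `σ`, with `S_τ = S_σ ∩ τ` for every face `τ` of `σ`. -/
structure MonoidalComplex (M : Type*) [AddCommGroup M] where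
  /-- the underlying fan `Δ` -/
  fan : RationalFan M
  /-- the semigroups `S_σ` -/
  S : fan.Cone → AddSubmonoid M
  fg : ∀ σ, (S σ).FG
  hull_eq : ∀ σ : fan.Cone, PointedCone.hull ℝ (latticeMap M '' (S σ : Set M)) = σ.1
  face : ∀ σ τ : fan.Cone, τ.1.IsFaceOf σ.1 →
    ∀ m : M, m ∈ S τ ↔ m ∈ S σ ∧ latticeMap M m ∈ τ.1

namespace MonoidalComplex

variable {M : Type*} [AddCommGroup M] (𝓜 : MonoidalComplex M)

/-- The lattice `Λ_σ = S_σ - S_σ`. -/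
def Λ (σ : 𝓜.fan.Cone) : AddSubgroup M := AddSubgroup.closure (𝓜.S σ : Set M)

/-- The support `|𝓜| = ⋃_σ S_σ`. -/
def support : Set M := {m | ∃ σ, m ∈ 𝓜.S σ}

variable {𝓜}

theorem latticeMap_mem {σ : 𝓜.fan.Cone} {m : M} (hm : m ∈ 𝓜.S σ) : latticeMap M m ∈ σ.1 := by
  rw [← 𝓜.hull_eq σ]
  exact PointedCone.subset_hull ⟨m, hm, rfl⟩

/-- `S_τ ∩ σ ⊆ S_σ`. -/
theorem mem_of_latticeMap_mem {σ τ : 𝓜.fan.Cone} {m : M} (hm : m ∈ 𝓜.S τ)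
    (h : latticeMap M m ∈ σ.1) : m ∈ 𝓜.S σ := by
  let ρ : 𝓜.fan.Cone := ⟨σ.1 ⊓ τ.1,
    𝓜.fan.face_mem _ σ.2 _ (𝓜.fan.inf_isFaceOf_left _ σ.2 _ τ.2)⟩
  have h1 : m ∈ 𝓜.S ρ := (𝓜.face τ ρ (𝓜.fan.inf_isFaceOf_right _ σ.2 _ τ.2) m).2
    ⟨hm, h, latticeMap_mem hm⟩
  exact ((𝓜.face σ ρ (𝓜.fan.inf_isFaceOf_left _ σ.2 _ τ.2) m).1 h1).1

/-- If `m`, `m'` lie in a common `S_τ` and `m + m'` lies in `S_σ`, then `m` lies in `S_σ`. -/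
theorem mem_of_add_mem {σ τ : 𝓜.fan.Cone} {m m' : M} (hm : m ∈ 𝓜.S τ) (hm' : m' ∈ 𝓜.S τ)
    (h : m + m' ∈ 𝓜.S σ) : m ∈ 𝓜.S σ := by
  refine mem_of_latticeMap_mem hm ?_
  have hf := 𝓜.fan.inf_isFaceOf_right _ σ.2 _ τ.2
  have h2 : latticeMap M m + latticeMap M m' ∈ σ.1 ⊓ τ.1 := by
    rw [← map_add]
    exact ⟨latticeMap_mem h, latticeMap_mem (add_mem hm hm')⟩
  exact (hf.mem_of_add_mem_left (latticeMap_mem hm) (latticeMap_mem hm') h2).1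

variable (𝓜)

theorem zero_mem_support : (0 : M) ∈ 𝓜.support := by
  obtain ⟨σ, hσ⟩ := 𝓜.fan.nonempty
  exact ⟨⟨σ, hσ⟩, zero_mem _⟩

/-- The toric face ring `k[𝓜]`: the `k`-vector space with basis `χ^m`, `m ∈ |𝓜|`. Its
multiplication is `χ^m χ^{m'} = χ^{m + m'}` if `m` and `m'` lie in a common semigroup `S_σ`, and
`χ^m χ^{m'} = 0` otherwise. -/
structure ToricFaceRing (k : Type*) [Field k] where
  /-- the coefficients of an element -/
  coeff : 𝓜.support →₀ k

namespace ToricFaceRing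

variable {𝓜} {k : Type*} [Field k]

/-- An element is given by its coefficients. -/
def coeffEquiv : 𝓜.ToricFaceRing k ≃ (𝓜.support →₀ k) where
  toFun := coeff
  invFun := mk
  left_inv _ := rfl
  right_inv _ := rfl

instance : AddCommGroup (𝓜.ToricFaceRing k) := coeffEquiv.addCommGroup

open Classical in
/-- The coefficients of `(a χ^m) (b χ^{m'})`: the product is `ab χ^{m + m'}` if `m` and `m'` lie
in a common semigroup `S_σ`, and `0` otherwise. -/
def monomialMul (m m' : 𝓜.support) (a b : k) : 𝓜.support →₀ k :=
  if h : ∃ σ, (m : M) ∈ 𝓜.S σ ∧ (m' : M) ∈ 𝓜.S σ then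
    Finsupp.single ⟨(m : M) + m', h.elim fun σ hσ => ⟨σ, add_mem hσ.1 hσ.2⟩⟩ (a * b)
  else 0

instance : Mul (𝓜.ToricFaceRing k) :=
  ⟨fun f g => ⟨f.coeff.sum fun m a => g.coeff.sum fun m' b => monomialMul m m' a b⟩⟩

instance : One (𝓜.ToricFaceRing k) := ⟨⟨Finsupp.single ⟨0, 𝓜.zero_mem_support⟩ 1⟩⟩

open Classical in
/-- The restriction map `k[𝓜] → k[S_σ] ⊆ k[M]` on coefficients, used to verify the ring axioms. -/
def restrCoeff (σ : 𝓜.fan.Cone) : (𝓜.support →₀ k) →+ AddMonoidAlgebra k M :=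
  Finsupp.liftAddHom fun m : 𝓜.support =>
    if (m : M) ∈ 𝓜.S σ then AddMonoidAlgebra.singleAddHom (m : M) else 0

open Classical in
theorem restrCoeff_single (σ : 𝓜.fan.Cone) (m : 𝓜.support) (a : k) :
    restrCoeff σ (Finsupp.single m a) =
      if (m : M) ∈ 𝓜.S σ then AddMonoidAlgebra.single (m : M) a else 0 := by
  unfold restrCoeff
  rw [Finsupp.liftAddHom_apply_single]
  split_ifs <;> rfl

theorem restrCoeff_monomialMul (σ : 𝓜.fan.Cone) (m m' : 𝓜.support) (a b : k) :
    restrCoeff σ (monomialMul m m' a b) =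
      restrCoeff σ (Finsupp.single m a) * restrCoeff σ (Finsupp.single m' b) := by
  classical
  rw [restrCoeff_single, restrCoeff_single]
  unfold monomialMul
  by_cases h : ∃ σ, (m : M) ∈ 𝓜.S σ ∧ (m' : M) ∈ 𝓜.S σ
  · rw [dif_pos h, restrCoeff_single]
    obtain ⟨τ, h3, h4⟩ := h
    by_cases h1 : (m : M) ∈ 𝓜.S σ
    · by_cases h2 : (m' : M) ∈ 𝓜.S σ
      · rw [if_pos (add_mem h1 h2), if_pos h1, if_pos h2, AddMonoidAlgebra.single_mul_single]
      · rw [if_neg h2, mul_zero, if_neg]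
        intro h5
        exact h2 (mem_of_add_mem h4 h3 (add_comm (m : M) m' ▸ h5))
    · rw [if_neg h1, zero_mul, if_neg]
      intro h5
      exact h1 (mem_of_add_mem h3 h4 h5)
  · rw [dif_neg h, map_zero]
    by_cases h1 : (m : M) ∈ 𝓜.S σ
    · rw [if_neg fun h2 => h ⟨σ, h1, h2⟩, mul_zero]
    · rw [if_neg h1, zero_mul]

theorem restrCoeff_eq_sum (σ : 𝓜.fan.Cone) (f : 𝓜.support →₀ k) :
    restrCoeff σ f = f.sum fun m a => restrCoeff σ (Finsupp.single m a) := by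
  conv_lhs => rw [← Finsupp.sum_single f]
  exact map_finsuppSum (restrCoeff σ) _ _

/-- The restriction map `k[𝓜] → k[S_σ] ⊆ k[M]`, used to verify the ring axioms. -/
def restr (σ : 𝓜.fan.Cone) (f : 𝓜.ToricFaceRing k) : AddMonoidAlgebra k M :=
  restrCoeff σ f.coeff

theorem restr_zero (σ : 𝓜.fan.Cone) : restr σ (0 : 𝓜.ToricFaceRing k) = 0 :=
  map_zero (restrCoeff σ)

theorem restr_add (σ : 𝓜.fan.Cone) (f g : 𝓜.ToricFaceRing k) :
    restr σ (f + g) = restr σ f + restr σ g :=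
  map_add (restrCoeff σ) f.coeff g.coeff

theorem restr_mul (σ : 𝓜.fan.Cone) (f g : 𝓜.ToricFaceRing k) :
    restr σ (f * g) = restr σ f * restr σ g := by
  have h : restr σ (f * g) = f.coeff.sum fun m a => g.coeff.sum fun m' b =>
      restrCoeff σ (monomialMul m m' a b) := by
    refine (map_finsuppSum (restrCoeff σ) _ _).trans ?_
    congr 1
    funext m a
    exact map_finsuppSum (restrCoeff σ) _ _
  rw [h, restr, restr, restrCoeff_eq_sum σ f.coeff, restrCoeff_eq_sum σ g.coeff, Finsupp.sum_mul]
  congr 1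
  funext m a
  rw [Finsupp.mul_sum]
  congr 1
  funext m' b
  exact restrCoeff_monomialMul σ m m' a b

theorem restr_one (σ : 𝓜.fan.Cone) : restr σ (1 : 𝓜.ToricFaceRing k) = 1 := by
  classical
  refine (restrCoeff_single σ _ _).trans ?_
  rw [if_pos (zero_mem _)]
  rfl

theorem coeff_restrCoeff (σ : 𝓜.fan.Cone) (m : 𝓜.support) (hm : (m : M) ∈ 𝓜.S σ)
    (f : 𝓜.support →₀ k) : (restrCoeff σ f).coeff (m : M) = f m := by
  classical
  induction f using Finsupp.induction_linear with
  | zero => simp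
  | add f g hf hg => simp [hf, hg]
  | single m' a =>
    rw [restrCoeff_single]
    by_cases h : m' = m
    · subst h
      simp [hm]
    · have h' : (m' : M) ≠ m := fun e => h (Subtype.ext e)
      split_ifs <;> simp [h, h']

theorem ext_restr {f g : 𝓜.ToricFaceRing k} (h : ∀ σ, restr σ f = restr σ g) : f = g := by
  refine coeffEquiv.injective (Finsupp.ext fun m => ?_)
  obtain ⟨σ, hσ⟩ := m.2
  change f.coeff m = g.coeff m
  rw [← coeff_restrCoeff σ m hσ f.coeff, ← coeff_restrCoeff σ m hσ g.coeff]
  exact congrArg (fun x : AddMonoidAlgebra k M => x.coeff (m : M)) (h σ)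

instance : CommRing (𝓜.ToricFaceRing k) where
  __ := (inferInstance : AddCommGroup (𝓜.ToricFaceRing k))
  left_distrib f g h := ext_restr fun σ => by simp only [restr_mul, restr_add, mul_add]
  right_distrib f g h := ext_restr fun σ => by simp only [restr_mul, restr_add, add_mul]
  zero_mul f := ext_restr fun σ => by simp only [restr_mul, restr_zero, zero_mul]
  mul_zero f := ext_restr fun σ => by simp only [restr_mul, restr_zero, mul_zero]
  mul_assoc f g h := ext_restr fun σ => by simp only [restr_mul, mul_assoc]
  one_mul f := ext_restr fun σ => by simp only [restr_mul, restr_one, one_mul]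
  mul_one f := ext_restr fun σ => by simp only [restr_mul, restr_one, mul_one]
  mul_comm f g := ext_restr fun σ => by simp only [restr_mul, mul_comm]

end ToricFaceRing

end MonoidalComplex

/-- A ring `A` is seminormal if for all `x, y ∈ A` with `x³ = y²` there is a unique `a ∈ A` with
`x = a²` and `y = a³`. -/
def IsSeminormalRing (A : Type*) [CommRing A] : Prop :=
  ∀ x y : A, x ^ 3 = y ^ 2 → ∃! a : A, x = a ^ 2 ∧ y = a ^ 3

/-- The depth of a local ring: the supremum of the lengths of the regular sequences contained in
the maximal ideal. -/
def localRingDepth (A : Type*) [CommRing A] [IsLocalRing A] : ℕ∞ :=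
  ⨆ (rs : List A) (_ : (∀ r ∈ rs, r ∈ IsLocalRing.maximalIdeal A) ∧
    RingTheory.Sequence.IsRegular A rs), (rs.length : ℕ∞)

/-- Serre's property `S_n`: `depth A_𝔭 ≥ min (n, dim A_𝔭)` for every prime ideal `𝔭` of `A`. -/
def SatisfiesSerre (n : ℕ) (A : Type*) [CommRing A] : Prop :=
  ∀ 𝔭 : PrimeSpectrum A,
    min (n : WithBot ℕ∞) (ringKrullDim (Localization.AtPrime 𝔭.asIdeal)) ≤
      (localRingDepth (Localization.AtPrime 𝔭.asIdeal) : WithBot ℕ∞)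

end

/-! ### Chains of relations, and Farkas' lemma over ordered rings. -/

noncomputable section

/-! Restriction to the facets embeds `k[𝓜]` in the product of the group algebras `k[M]`, and the
image is described degree by degree: a family `(c_F χ^m)_F` comes from `k[𝓜]` exactly when it is
`Compatible` (`mem_range_toPi`). The element `facetSum` is a nonzerodivisor and becomes a unit in
this product. So at a prime `p` containing it, depth at least two means: whenever `p b ⊆ k[𝓜]` for a
`b` in the product, `s b ∈ k[𝓜]` for some `s ∉ p`.

Every prime `p` has a cone `σ` with `P_σ ⊆ p` and no monomial of `S_σ` in `p`
(`exists_cone_of_isPrime`). If `σ` is a facet, `k[𝓜]_p` is a localization of a Laurent polynomial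
ring, hence factorial. If `σ` is not a facet but only facets lie strictly above it, `P_σ` has height
at most one by the principal ideal theorem, so a `p` of height at least two contains some `f ∉ P_σ`,
and a unique-sums argument trades `f` for a monomial of `S_σ`. In the remaining case the depth
condition is a statement about single degrees `m` and coefficient vectors `c`
(`satisfiesSerre_two_of_compatible`).

From `S₂` to combinatorics, this criterion is applied to test families. If 1-connectedness fails,
take a reachable and an unreachable facet whose intersection `τ` has maximal dimension. The
indicator of the reachable facets containing `τ` is compatible after multiplication by any monomial
outside `S_τ`, but not after one in `S_τ`. For the lattices, a point of all `Λ_ρ`, `ρ > σ`, gives a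
family which seminormality makes compatible outside `S_σ`, so that depth two forces the point into
`Λ_σ`; descending induction finishes.

Conversely, 1-connectedness makes the coefficients agree, by crossing walls of codimension one. What
remains is the membership `n u_σ + m ∈ S_F` where `c_F ≠ 0`. It follows from `S₂` of the component
`k[𝓜]/P_F`, or, in the seminormal case, from convexity together with the lattice condition, because
lattice points in the relative interior of `τ` that lie in `Λ_τ` lie in `S_τ`. -/

theorem Relation.ReflTransGen.exists_seq {α : Type*} {r : α → α → Prop} {a b : α}
    (h : Relation.ReflTransGen r a b) :
    ∃ (n : ℕ) (f : ℕ → α), f 0 = a ∧ f n = b ∧ ∀ i < n, r (f i) (f (i + 1)) := by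
  induction h with
  | refl => exact ⟨0, fun _ => a, rfl, rfl, by simp⟩
  | @tail b c _ hbc ih =>
    obtain ⟨n, f, h0, hn, hf⟩ := ih
    refine ⟨n + 1, fun i => if i ≤ n then f i else c, by simp [h0], by simp, fun i hi => ?_⟩
    rcases Nat.lt_succ_iff_lt_or_eq.1 hi with hi | rfl
    · simpa [hi.le, Nat.succ_le_of_lt hi] using hf i hi
    · simpa [hn] using hbc

/-- Farkas' lemma over an ordered ring, up to positive multiples. -/
theorem exists_smul_mem_hull_or_exists_dual {R E ι : Type*} [CommRing R] [LinearOrder R]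
    [IsStrictOrderedRing R] [AddCommGroup E] [Module R E]
    (hE : ∀ x : E, x ≠ 0 → ∃ l : E →ₗ[R] R, l x ≠ 0) (s : Finset ι) (f : ι → E) (x : E) :
    (∃ j : R, 0 < j ∧ j • x ∈ PointedCone.hull R (f '' (s : Set ι))) ∨
      ∃ l : E →ₗ[R] R, (∀ i ∈ s, 0 ≤ l (f i)) ∧ l x < 0 := by
  classical
  induction s using Finset.induction_on generalizing f x with
  | empty =>
    by_cases hx : x = 0
    · exact Or.inl ⟨1, one_pos, by simp [hx]⟩
    · obtain ⟨l, hl⟩ := hE x hx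
      rcases lt_or_gt_of_ne hl with h | h
      · exact Or.inr ⟨l, by simp, h⟩
      · exact Or.inr ⟨-l, by simp, by simpa using h⟩
  | insert v s _ ih =>
    rcases ih f x with ⟨j, hj, hx⟩ | ⟨l, hl, hx⟩
    · refine Or.inl ⟨j, hj, Submodule.span_mono (Set.image_mono ?_) hx⟩
      simp
    by_cases hv : 0 ≤ l (f v)
    · refine Or.inr ⟨l, fun i hi => ?_, hx⟩
      rcases Finset.mem_insert.1 hi with rfl | hi
      exacts [hv, hl i hi]
    push Not at hv
    -- The projection onto `ker l` along `f v`, scaled by `-l (f v) > 0` to avoid division. It kills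
    -- `f v`, so a functional found for the projected data is nonnegative on `f v` after composition
    -- with `T`.
    let T : E →ₗ[R] E := (-l (f v)) • LinearMap.id + l.smulRight (f v)
    have hT : ∀ w, T w = (-l (f v)) • w + l w • f v := fun w => rfl
    rcases ih (T ∘ f) (T x) with ⟨j, hj, h⟩ | ⟨l', hl', h⟩
    · refine Or.inl ⟨j * (-l (f v)), mul_pos hj (neg_pos.2 hv), ?_⟩
      rw [Set.image_comp] at h
      have key : ∀ y ∈ PointedCone.hull R (T '' (f '' (s : Set ι))), ∃ a : R, 0 ≤ a ∧
          y - a • f v ∈ PointedCone.hull R (f '' (s : Set ι)) := by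
        intro y hy
        induction hy using Submodule.span_induction with
        | mem y hy =>
          obtain ⟨_, ⟨i, hi, rfl⟩, rfl⟩ := hy
          refine ⟨l (f i), hl i hi, ?_⟩
          rw [hT, add_sub_cancel_right]
          exact PointedCone.smul_mem _ (neg_pos.2 hv).le (Submodule.subset_span ⟨i, hi, rfl⟩)
        | zero => exact ⟨0, le_rfl, by simp⟩
        | add y z _ _ hy hz =>
          obtain ⟨a, ha, hy⟩ := hy
          obtain ⟨b, hb, hz⟩ := hz
          refine ⟨a + b, add_nonneg ha hb, ?_⟩
          convert add_mem hy hz using 1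
          rw [add_smul]; abel
        | smul c y _ hy =>
          obtain ⟨a, ha, hy⟩ := hy
          refine ⟨c * a, mul_nonneg c.2 ha, ?_⟩
          convert Submodule.smul_mem _ c hy using 1
          rw [smul_sub, mul_smul]; rfl
      obtain ⟨a, ha, h⟩ := key _ h
      have hmono : PointedCone.hull R (f '' (s : Set ι)) ≤
          PointedCone.hull R (f '' ((insert v s : Finset ι) : Set ι)) :=
        Submodule.span_mono (Set.image_mono (by simp))
      -- Undoing the projection leaves this multiple of `f v`; it is nonnegative because `l x < 0`.
      have h2 : (a - j * l x) • f v ∈ PointedCone.hull R (f '' ((insert v s : Finset ι) : Set ι)) :=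
        PointedCone.smul_mem _ (by nlinarith) (Submodule.subset_span ⟨v, by simp, rfl⟩)
      convert add_mem (hmono h) h2 using 1
      rw [hT]
      module
    · refine Or.inr ⟨l' ∘ₗ T, fun i hi => ?_, h⟩
      rcases Finset.mem_insert.1 hi with rfl | hi
      · have : T (f i) = 0 := by rw [hT]; module
        simp [this]
      · exact hl' i hi

theorem farkas {E : Type*} [AddCommGroup E] [Module ℝ E] (s : Finset E) (x : E)
    (hx : x ∉ PointedCone.hull ℝ (s : Set E)) :
    ∃ l : E →ₗ[ℝ] ℝ, (∀ v ∈ s, 0 ≤ l v) ∧ l x < 0 := by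
  rcases exists_smul_mem_hull_or_exists_dual (R := ℝ) (fun x hx => by
    by_contra! h
    exact hx ((Module.forall_dual_apply_eq_zero_iff ℝ x).1 h)) s id x with ⟨j, hj, h⟩ | h
  · rw [Set.image_id] at h
    exact absurd ((PointedCone.smul_mem_iff _ hj).1 h) hx
  · exact h

/-- Farkas' lemma over `ℤ`: an integral cone over the generators is the monoid they generate, and an
integral functional separating `m` from them would extend to `M_ℝ` and separate there too. -/
theorem exists_nsmul_mem_of_latticeMap_mem_hull {M : Type*} [AddCommGroup M] [Module.Free ℤ M]
    [Module.Finite ℤ M] (S : AddSubmonoid M) (hS : S.FG) (m : M)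
    (hm : latticeMap M m ∈ PointedCone.hull ℝ (latticeMap M '' (S : Set M))) :
    ∃ j : ℕ, 0 < j ∧ j • m ∈ S := by
  obtain ⟨s, rfl⟩ := hS
  rcases exists_smul_mem_hull_or_exists_dual (R := ℤ) (fun x hx => by
    by_contra! h
    exact hx ((Module.forall_dual_apply_eq_zero_iff ℤ x).1 h)) s id m with ⟨j, hj, h⟩ | ⟨l, hl, h⟩
  · refine ⟨j.toNat, by omega, ?_⟩
    have h1 : j.toNat • m = j • m := by
      rw [← natCast_zsmul, Int.toNat_of_nonneg hj.le]
    rw [h1]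
    rw [Set.image_id] at h
    generalize j • m = x at h ⊢
    induction h using Submodule.span_induction with
    | mem y hy => exact AddSubmonoid.subset_closure hy
    | zero => exact zero_mem _
    | add y z _ _ hy hz => exact add_mem hy hz
    | smul c y _ hy =>
      obtain ⟨c, hc⟩ := c
      lift c to ℕ using hc
      change (c : ℤ) • y ∈ _
      rw [natCast_zsmul]
      exact nsmul_mem hy c
  · exfalso
    let L : ℝ ⊗[ℤ] M →ₗ[ℝ] ℝ :=
      TensorProduct.AlgebraTensorModule.lift ((LinearMap.lsmul ℝ (M →ₗ[ℤ] ℝ)).flip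
        ((Algebra.linearMap ℤ ℝ).comp l))
    have hL : ∀ m, L (latticeMap M m) = (l m : ℝ) := fun m => by
      simp [L, latticeMap]
    have hS : ∀ y ∈ AddSubmonoid.closure (s : Set M), 0 ≤ l y := by
      intro y hy
      induction hy using AddSubmonoid.closure_induction with
      | mem y hy => exact hl y hy
      | zero => simp
      | add y z _ _ hy hz => rw [map_add]; exact add_nonneg hy hz
    have : ∀ y ∈ PointedCone.hull ℝ (latticeMap M '' (AddSubmonoid.closure (s : Set M) : Set M)),
        0 ≤ L y := by
      intro y hy
      induction hy using Submodule.span_induction with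
      | mem y hy =>
        obtain ⟨y, hy, rfl⟩ := hy
        rw [hL]
        exact_mod_cast hS y hy
      | zero => simp
      | add y z _ _ hy hz => rw [map_add]; exact add_nonneg hy hz
      | smul c y _ hy =>
        change 0 ≤ L ((c : ℝ) • y)
        rw [map_smul]
        exact mul_nonneg c.2 hy
    have := this _ hm
    rw [hL] at this
    have : (0 : ℤ) ≤ l m := by exact_mod_cast this
    exact absurd h (not_lt.2 this)

/-! ### Faces of cones and separating functionals. -/

namespace PointedCone

variable {E : Type*} [AddCommGroup E] [Module ℝ E]

/-- The smallest face of `σ` containing `x`, if `x ∈ σ`. -/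
def minFace (σ : PointedCone ℝ E) (x : E) : PointedCone ℝ E where
  carrier := {y | y ∈ σ ∧ ∃ c : ℝ, 0 ≤ c ∧ c • x - y ∈ σ}
  add_mem' := by
    rintro a b ⟨ha, c, hc, hca⟩ ⟨hb, d, hd, hdb⟩
    refine ⟨add_mem ha hb, c + d, add_nonneg hc hd, ?_⟩
    convert add_mem hca hdb using 1
    module
  zero_mem' := ⟨zero_mem _, 0, le_rfl, by simp⟩
  smul_mem' := by
    rintro ⟨a, ha⟩ y ⟨hy, c, hc, hcy⟩
    refine ⟨Submodule.smul_mem _ _ hy, a * c, mul_nonneg ha hc, ?_⟩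
    convert PointedCone.smul_mem _ ha hcy using 1
    rw [smul_sub, mul_smul]; rfl

theorem mem_minFace {σ : PointedCone ℝ E} {x y : E} :
    y ∈ minFace σ x ↔ y ∈ σ ∧ ∃ c : ℝ, 0 ≤ c ∧ c • x - y ∈ σ := Iff.rfl

theorem self_mem_minFace {σ : PointedCone ℝ E} {x : E} (hx : x ∈ σ) : x ∈ minFace σ x :=
  ⟨hx, 1, zero_le_one, by simp⟩

theorem minFace_isFaceOf (σ : PointedCone ℝ E) (x : E) :
    (minFace σ x).IsFaceOf σ := by
  refine .of_mem_of_add_mem_left (fun y hy => hy.1) fun {y z} hy hz h => ?_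
  obtain ⟨-, c, hc, h⟩ := h
  refine ⟨hy, c, hc, ?_⟩
  convert add_mem h hz using 1
  abel

theorem exists_smul_sub_mem_minFace {σ : PointedCone ℝ E} {x y : E}
    (hy : y ∈ minFace σ x) : ∃ c : ℝ, 0 ≤ c ∧ c • x - y ∈ minFace σ x := by
  obtain ⟨h, c, hc, hcy⟩ := hy
  refine ⟨c, hc, hcy, c, hc, ?_⟩
  simpa using h

/-- The face of `σ` cut out by a functional which is nonnegative on `σ`. -/
def kerFace (σ : PointedCone ℝ E) (l : E →ₗ[ℝ] ℝ) : PointedCone ℝ E :=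
  σ ⊓ ofSubmodule (LinearMap.ker l)

theorem mem_kerFace {σ : PointedCone ℝ E} {l : E →ₗ[ℝ] ℝ} {x : E} :
    x ∈ kerFace σ l ↔ x ∈ σ ∧ l x = 0 := Iff.rfl

theorem kerFace_isFaceOf {σ : PointedCone ℝ E} {l : E →ₗ[ℝ] ℝ} (hl : ∀ x ∈ σ, 0 ≤ l x) :
    (kerFace σ l).IsFaceOf σ := by
  refine .of_mem_of_add_mem_left (fun y hy => hy.1) fun {y z} hy hz h => ?_
  refine mem_kerFace.2 ⟨hy, ?_⟩
  have h1 := (mem_kerFace.1 h).2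
  rw [map_add] at h1
  linarith [hl y hy, hl z hz]

theorem nonneg_of_mem_hull {V : Set E} {l : E →ₗ[ℝ] ℝ} (hl : ∀ v ∈ V, 0 ≤ l v) {x : E}
    (hx : x ∈ hull ℝ V) : 0 ≤ l x := by
  induction hx using Submodule.span_induction with
  | mem y hy => exact hl y hy
  | zero => simp
  | add y z _ _ hy hz => rw [map_add]; exact add_nonneg hy hz
  | smul c y _ hy =>
    change 0 ≤ l ((c : ℝ) • y)
    rw [map_smul]
    exact mul_nonneg c.2 hy

theorem IsFaceOf.eq_hull {V : Set E} {σ : PointedCone ℝ E} (hσ : σ.IsFaceOf (hull ℝ V)) :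
    σ = hull ℝ {v | v ∈ V ∧ v ∈ σ} := by
  apply le_antisymm
  · intro x hx
    -- The free complement `z` lets the induction pass to summands of `y`, since the other summand
    -- can be moved into `z`.
    have key : ∀ y ∈ hull ℝ V, ∀ z ∈ hull ℝ V, y + z ∈ σ → y ∈ hull ℝ {v | v ∈ V ∧ v ∈ σ} := by
      intro y hy
      induction hy using Submodule.span_induction with
      | mem y hy =>
        intro z hz h
        exact subset_hull ⟨hy, hσ.mem_of_add_mem_left (subset_hull hy) hz h⟩
      | zero => intros; exact zero_mem _
      | add a b ha hb iha ihb =>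
        intro z hz h
        refine add_mem (iha (b + z) (add_mem hb hz) (by rwa [← add_assoc]))
          (ihb (a + z) (add_mem ha hz) (by convert h using 1; abel))
      | smul c a ha ih =>
        intro z hz h
        rcases eq_or_lt_of_le c.2 with hc | hc
        · have : c = 0 := Subtype.ext hc.symm
          rw [this, zero_smul]
          exact zero_mem _
        · refine Submodule.smul_mem _ _ (ih 0 (zero_mem _) ?_)
          rw [add_zero]
          exact hσ.mem_of_smul_add_mem (a := (c : ℝ)) ha hz hc h
    exact key x (hσ.le hx) 0 (zero_mem _) (by simpa using hx)
  · exact Submodule.span_le.2 fun v hv => hv.2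

/-- If `σ` is a face of codimension at least two of `τ` and `m` does not lie in `τ + span σ`,
there is a supporting hyperplane of `τ` through `σ` separating `m` from `τ` which cuts out a face
strictly larger than `σ`. -/
theorem exists_separating_functional [Module.Finite ℝ E] {V : Finset E} {σ : PointedCone ℝ E}
    (hσ : σ.IsFaceOf (hull ℝ (V : Set E)))
    (hdim : Module.finrank ℝ (Submodule.span ℝ (σ : Set E)) + 2 ≤
      Module.finrank ℝ (Submodule.span ℝ (hull ℝ (V : Set E) : Set E)))
    {m : E} (hm : ∀ f ∈ hull ℝ (V : Set E), ∀ b ∈ σ, m ≠ f - b) :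
    ∃ l : E →ₗ[ℝ] ℝ, (∀ x ∈ hull ℝ (V : Set E), 0 ≤ l x) ∧ (∀ x ∈ σ, l x = 0) ∧ l m < 0 ∧
      ∃ v ∈ V, v ∉ σ ∧ l v = 0 := by
  classical
  -- Adjoining the negatives of the generators in `σ` stays within `hull V - σ`, and any functional
  -- nonnegative on `W` vanishes on `σ`.
  let W : Finset E := V ∪ (V.filter (· ∈ σ)).image Neg.neg
  have hW : ∀ y ∈ hull ℝ (W : Set E), ∃ f ∈ hull ℝ (V : Set E), ∃ b ∈ σ, y = f - b := by
    intro y hy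
    induction hy using Submodule.span_induction with
    | mem y hy =>
      rcases Finset.mem_union.1 (Finset.mem_coe.1 hy) with hy | hy
      · exact ⟨y, subset_hull hy, 0, zero_mem _, by simp⟩
      · obtain ⟨z, hz, rfl⟩ := Finset.mem_image.1 hy
        exact ⟨0, zero_mem _, z, (Finset.mem_filter.1 hz).2, by simp⟩
    | zero => exact ⟨0, zero_mem _, 0, zero_mem _, by simp⟩
    | add y z _ _ hy hz =>
      obtain ⟨f, hf, b, hb, rfl⟩ := hy
      obtain ⟨f', hf', b', hb', rfl⟩ := hz
      exact ⟨f + f', add_mem hf hf', b + b', add_mem hb hb', by abel⟩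
    | smul c y _ hy =>
      obtain ⟨f, hf, b, hb, rfl⟩ := hy
      exact ⟨c • f, Submodule.smul_mem _ _ hf, c • b, Submodule.smul_mem _ _ hb, smul_sub _ _ _⟩
  obtain ⟨l, hl, hlm⟩ := farkas W m fun h => by
    obtain ⟨f, hf, b, hb, h⟩ := hW m h
    exact hm f hf b hb h
  have hlV : ∀ v ∈ V, 0 ≤ l v := fun v hv => hl v (Finset.mem_union_left _ hv)
  have hσzero : ∀ l : E →ₗ[ℝ] ℝ, (∀ v ∈ V, v ∈ σ → l v = 0) → ∀ x ∈ σ, l x = 0 := by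
    intro l hl x hx
    rw [hσ.eq_hull] at hx
    refine le_antisymm ?_ (nonneg_of_mem_hull (fun v hv => (hl v hv.1 hv.2).ge) hx)
    have := nonneg_of_mem_hull (l := -l) (fun v hv => by simp [hl v hv.1 hv.2]) hx
    simpa using this
  have hlσ : ∀ x ∈ σ, l x = 0 := hσzero l fun v hv hvσ => le_antisymm (by
    have := hl (-v) (Finset.mem_union_right _ (Finset.mem_image_of_mem _ (by simp [hv, hvσ])))
    simpa using this) (hlV v hv)
  by_cases h0 : ∃ v ∈ V, v ∉ σ ∧ l v = 0
  · exact ⟨l, fun x hx => nonneg_of_mem_hull hlV hx, hlσ, hlm, h0⟩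
  push Not at h0
  -- Now `l` is positive on every generator outside `σ`. It is tilted by a functional `g` vanishing
  -- on `U`, which keeps the values on `σ` and at `m`; codimension two leaves a generator outside
  -- `U`.
  let U : Submodule ℝ E := Submodule.span ℝ (σ : Set E) ⊔ Submodule.span ℝ {m}
  obtain ⟨w, hwV, hwU⟩ : ∃ w ∈ V, w ∉ U := by
    by_contra! hcon
    have h1 : Submodule.span ℝ (hull ℝ (V : Set E) : Set E) ≤ U := by
      refine Submodule.span_le.2 fun x hx => ?_
      exact (Submodule.span_le (p := (U : PointedCone ℝ E))).2 (fun v hv => hcon v hv) hx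
    have h2 := Submodule.finrank_mono h1
    have h3 := Submodule.finrank_add_le_finrank_add_finrank (Submodule.span ℝ (σ : Set E))
      (Submodule.span ℝ {m})
    have h4 := finrank_span_le_card (R := ℝ) ({m} : Set E)
    simp only [Set.toFinset_singleton, Finset.card_singleton] at h4
    change Module.finrank ℝ U ≤ _ at h3
    omega
  obtain ⟨g, hgw, hgU⟩ : ∃ g : E →ₗ[ℝ] ℝ, g w < 0 ∧ ∀ x ∈ U, g x = 0 := by
    obtain ⟨g, hg, hU⟩ := Submodule.exists_le_ker_of_notMem hwU
    rcases lt_or_gt_of_ne hg with h | h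
    · exact ⟨g, h, fun x hx => hU hx⟩
    · exact ⟨-g, by simpa using h, fun x hx => by simpa using hU hx⟩
  have hgσ : ∀ x ∈ σ, g x = 0 := fun x hx =>
    hgU x (Submodule.mem_sup_left (Submodule.subset_span hx))
  have hgm : g m = 0 := hgU m (Submodule.mem_sup_right (Submodule.mem_span_singleton_self m))
  -- The minimal ratio is the first `t` at which `l + t • g` vanishes on a generator outside `σ`,
  -- while still nonnegative on all of `V`.
  obtain ⟨v, hv, hmin⟩ := Finset.exists_min_image (V.filter fun v => g v < 0)
    (fun v => l v / (-g v)) ⟨w, by simp [hwV, hgw]⟩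
  obtain ⟨hvV, hgv⟩ := Finset.mem_filter.1 hv
  have hvσ : v ∉ σ := fun h => hgv.ne (hgσ v h)
  set t := l v / (-g v) with ht
  have ht0 : 0 ≤ t := div_nonneg (hlV v hvV) (by linarith)
  refine ⟨l + t • g, fun x hx => nonneg_of_mem_hull (fun z hz => ?_) hx,
    fun x hx => by simp [hlσ x hx, hgσ x hx], by simpa [hgm] using hlm, v, hvV, hvσ, ?_⟩
  · simp only [LinearMap.add_apply, LinearMap.smul_apply, smul_eq_mul]
    by_cases hz' : g z < 0
    · have h1 := hmin z (Finset.mem_filter.2 ⟨hz, hz'⟩)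
      rw [le_div_iff₀ (by linarith)] at h1
      linarith
    · push Not at hz'
      exact add_nonneg (hlV z hz) (mul_nonneg ht0 hz')
  · simp only [LinearMap.add_apply, LinearMap.smul_apply, smul_eq_mul, ht]
    field_simp [hgv.ne]
    simp

/-- A proper face of a cone spans a space of smaller dimension. -/
theorem IsFaceOf.finrank_lt [Module.Finite ℝ E] {σ τ : PointedCone ℝ E} (h : σ.IsFaceOf τ)
    (hne : σ ≠ τ) : Module.finrank ℝ (Submodule.span ℝ (σ : Set E)) <
      Module.finrank ℝ (Submodule.span ℝ (τ : Set E)) := by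
  refine Submodule.finrank_lt_finrank_of_lt (lt_of_le_of_ne (Submodule.span_mono h.le) ?_)
  intro heq
  refine hne (le_antisymm h.le fun x hx => ?_)
  have hspan : ∀ y ∈ Submodule.span ℝ (σ : Set E), ∃ a ∈ σ, ∃ b ∈ σ, y = a - b := by
    intro y hy
    induction hy using Submodule.span_induction with
    | mem y hy => exact ⟨y, hy, 0, zero_mem _, by simp⟩
    | zero => exact ⟨0, zero_mem _, 0, zero_mem _, by simp⟩
    | add y z _ _ hy hz =>
      obtain ⟨f, hf, b, hb, rfl⟩ := hy
      obtain ⟨f', hf', b', hb', rfl⟩ := hz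
      exact ⟨f + f', add_mem hf hf', b + b', add_mem hb hb', by abel⟩
    | smul c y _ hy =>
      obtain ⟨f, hf, b, hb, rfl⟩ := hy
      rcases le_total 0 c with hc | hc
      · exact ⟨c • f, smul_mem _ hc hf, c • b, smul_mem _ hc hb, smul_sub _ _ _⟩
      · exact ⟨(-c) • b, smul_mem _ (neg_nonneg.2 hc) hb, (-c) • f,
          smul_mem _ (neg_nonneg.2 hc) hf, by module⟩
  obtain ⟨a, ha, b, hb, rfl⟩ := hspan x (heq ▸ Submodule.subset_span hx)
  exact h.mem_of_add_mem_left hx (h.le hb) (by simpa using ha)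

end PointedCone

/-! ### Facets, walls and dimensions in a fan. -/

namespace RationalFan

variable {M : Type*} [AddCommGroup M] {Δ : RationalFan M}

theorem isFaceOf_of_le {σ τ : Δ.Cone} (h : σ ≤ τ) : σ.1.IsFaceOf τ.1 := by
  have := Δ.inf_isFaceOf_right _ σ.2 _ τ.2
  rwa [inf_eq_left.2 (show σ.1 ≤ τ.1 from h)] at this

/-- The intersection of two cones of a fan. -/
def meet (σ τ : Δ.Cone) : Δ.Cone :=
  ⟨σ.1 ⊓ τ.1, Δ.face_mem _ σ.2 _ (Δ.inf_isFaceOf_left _ σ.2 _ τ.2)⟩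

theorem meet_le_left (σ τ : Δ.Cone) : meet σ τ ≤ σ := (inf_le_left : σ.1 ⊓ τ.1 ≤ σ.1)

theorem meet_le_right (σ τ : Δ.Cone) : meet σ τ ≤ τ := (inf_le_right : σ.1 ⊓ τ.1 ≤ τ.1)

theorem le_meet {ρ σ τ : Δ.Cone} (h : ρ ≤ σ) (h' : ρ ≤ τ) : ρ ≤ meet σ τ :=
  le_inf (show ρ.1 ≤ σ.1 from h) h'

/-- Summands in a cone `F` of an element of another cone `F'` lie in `F'`. -/
theorem mem_of_sub_mem {F F' : Δ.Cone} {x y : ℝ ⊗[ℤ] M}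
    (hy : y ∈ F.1) (hxy : x - y ∈ F.1) (hx : x ∈ F'.1) : y ∈ F'.1 := by
  have h : y + (x - y) = x := add_sub_cancel y x
  refine ((Δ.inf_isFaceOf_left _ F.2 _ F'.2).mem_of_add_mem_left hy hxy ?_).2
  rw [h]
  exact ⟨h ▸ add_mem hy hxy, hx⟩

theorem exists_isFacet_ge (σ : Δ.Cone) : ∃ F : Δ.Cone, IsFacet F ∧ σ ≤ F := by
  obtain ⟨F, h, hF⟩ := (Set.toFinite (Set.univ : Set Δ.Cone)).exists_le_maximal (Set.mem_univ σ)
  exact ⟨F, fun τ hτ => hF.2 (Set.mem_univ τ) hτ, h⟩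

/-- Consecutive facets of a chain share a wall of codimension one in both, so they have the same
dimension. -/
theorem IsOneConnected.exists_coneDim_eq (h : Δ.IsOneConnected) :
    ∃ d, ∀ F : Δ.Cone, IsFacet F → coneDim F.1 = d := by
  obtain ⟨σ, hσ⟩ := Δ.nonempty
  obtain ⟨F, hF, -⟩ := exists_isFacet_ge ⟨σ, hσ⟩
  refine ⟨coneDim F.1, fun F' hF' => ?_⟩
  by_cases hne : F = F'
  · rw [hne]
  obtain ⟨n, G, h0, hn, -, hG⟩ := h F F' hF hF' hne
  have : ∀ i ≤ n, coneDim (G i).1 = coneDim F.1 := by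
    intro i
    induction i with
    | zero => simp [h0]
    | succ i ih =>
      intro hi
      have := hG i (by omega)
      rw [← ih (by omega)]
      omega
  rw [← hn]
  exact this n le_rfl

/-- A relation between facets sharing a cone `σ` holds as soon as it is invariant under crossing a
face of codimension one containing `σ`. -/
theorem IsOneConnected.induction (h : Δ.IsOneConnected) {F F' : Δ.Cone} (hF : IsFacet F)
    (hF' : IsFacet F') (p : Δ.Cone → Prop) (hp : p F)
    (step : ∀ G G' : Δ.Cone, IsFacet G → IsFacet G' → meet F F' ≤ meet G G' →
      coneDim (meet G G').1 + 1 = coneDim G.1 → p G → p G') : p F' := by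
  by_cases hne : F = F'
  · rwa [← hne]
  obtain ⟨n, G, h0, hn, h1, h2⟩ := h F F' hF hF' hne
  have : ∀ i ≤ n, p (G i) := by
    intro i
    induction i with
    | zero => intro; rwa [h0]
    | succ i ih =>
      intro hi
      exact step (G i) (G (i + 1)) (h1 i (by omega)).1 (h1 _ hi).1
        (le_meet (h1 i (by omega)).2 (h1 _ hi).2) (h2 i (by omega)).1 (ih (by omega))
  rw [← hn]
  exact this n le_rfl

variable [Module.Finite ℤ M]

theorem coneDim_lt {σ τ : Δ.Cone} (h : σ < τ) : coneDim σ.1 < coneDim τ.1 :=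
  (isFaceOf_of_le h.le).finrank_lt fun e => h.ne (Subtype.ext e)

theorem coneDim_le {σ τ : Δ.Cone} (h : σ ≤ τ) : coneDim σ.1 ≤ coneDim τ.1 := by
  rcases eq_or_lt_of_le h with rfl | h
  exacts [le_rfl, (coneDim_lt h).le]

/-- The cone `ρ` is the face `F ∩ ker l`; it exceeds `σ` because `l` also vanishes on a generator of
`F` outside `σ`. -/
theorem exists_lt_separating {σ F : Δ.Cone} (h : σ ≤ F)
    (hdim : coneDim σ.1 + 2 ≤ coneDim F.1) {x : ℝ ⊗[ℤ] M} (hx : ∀ f ∈ F.1, ∀ b ∈ σ.1, x ≠ f - b) :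
    ∃ ρ : Δ.Cone, σ < ρ ∧ ρ ≤ F ∧ ∃ l : ℝ ⊗[ℤ] M →ₗ[ℝ] ℝ, (∀ y ∈ F.1, 0 ≤ l y) ∧
      (∀ y ∈ ρ.1, l y = 0) ∧ l x < 0 := by
  classical
  obtain ⟨s, hs⟩ := Δ.rational _ F.2
  have hs' : F.1 = PointedCone.hull ℝ ((s.image (latticeMap M) : Finset _) : Set (ℝ ⊗[ℤ] M)) := by
    rw [hs, Finset.coe_image]
  obtain ⟨l, hl, hσ, hlx, v, hv, hvσ, hlv⟩ :=
    PointedCone.exists_separating_functional (V := s.image (latticeMap M)) (σ := σ.1)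
      (hs' ▸ isFaceOf_of_le h) (by rw [← hs']; exact hdim) (m := x) (by rw [← hs']; exact hx)
  have hvF : v ∈ F.1 := by rw [hs']; exact PointedCone.subset_hull hv
  rw [← hs'] at hl
  refine ⟨⟨PointedCone.kerFace F.1 l, Δ.face_mem _ F.2 _ (PointedCone.kerFace_isFaceOf hl)⟩, ?_,
    fun y hy => (PointedCone.mem_kerFace.1 hy).1, l, hl,
    fun y hy => (PointedCone.mem_kerFace.1 hy).2, hlx⟩
  refine lt_of_le_of_ne (fun y hy => PointedCone.mem_kerFace.2 ⟨h hy, hσ y hy⟩) fun e => hvσ ?_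
  rw [e]
  exact PointedCone.mem_kerFace.2 ⟨hvF, hlv⟩

/-- Between cones of a fan whose dimensions differ by at least two there is another cone. -/
theorem exists_between {σ F : Δ.Cone} (h : σ < F) (hdim : coneDim σ.1 + 2 ≤ coneDim F.1) :
    ∃ ρ : Δ.Cone, σ < ρ ∧ ρ < F := by
  obtain ⟨v, hv, hvσ⟩ := SetLike.exists_of_lt (show σ.1 < F.1 from h)
  -- Separating `-v` for some `v ∈ F` outside `σ` gives `l v > 0`, so the face cut out by `l` is
  -- proper.
  obtain ⟨ρ, h1, h2, l, -, h4, h5⟩ := exists_lt_separating h.le hdim (x := -v) fun f hf b hb e => by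
    refine hvσ ((isFaceOf_of_le h.le).mem_of_add_mem_left hv hf ?_)
    have : v + f = b := by rw [← sub_eq_zero, ← sub_eq_zero.2 e.symm]; abel
    rwa [this]
  refine ⟨ρ, h1, lt_of_le_of_ne h2 ?_⟩
  rintro rfl
  have := h4 v hv
  rw [map_neg, this] at h5
  simp at h5

theorem codim_eq {d : ℕ} (h : ∀ F : Δ.Cone, IsFacet F → coneDim F.1 = d) (σ : Δ.Cone) :
    codim σ = ((d - coneDim σ.1 : ℕ) : ℕ∞) := by
  refine le_antisymm (iSup₂_le fun τ hτ => ?_) ?_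
  · obtain ⟨F, hF, hle⟩ := exists_isFacet_ge τ
    have := coneDim_le hle
    rw [h F hF] at this
    exact_mod_cast Nat.sub_le_sub_right this _
  · obtain ⟨F, hF, hle⟩ := exists_isFacet_ge σ
    refine le_iSup₂_of_le F hle ?_
    rw [h F hF]

theorem codim_pos_iff (σ : Δ.Cone) : 0 < codim σ ↔ ¬ IsFacet σ := by
  constructor
  · intro h hσ
    refine h.ne' (le_antisymm (iSup₂_le fun τ hτ => ?_) bot_le)
    have : τ = σ := le_antisymm (hσ hτ) hτ
    simp [this]
  · intro h
    rw [IsFacet, not_isMax_iff] at h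
    obtain ⟨τ, h⟩ := h
    have := coneDim_lt h
    refine lt_of_lt_of_le ?_ (le_iSup₂_of_le τ h.le le_rfl)
    exact_mod_cast Nat.sub_pos_of_lt this

end RationalFan

/-! ### Semigroups, lattices and relative interior points. -/

namespace MonoidalComplex

open RationalFan

variable {M : Type*} [AddCommGroup M] (𝓜 : MonoidalComplex M)

/-- The sum of a finite set of generators of `S_σ`, an element of the relative interior. -/
def genSum (σ : 𝓜.fan.Cone) : M := ∑ m ∈ (𝓜.fg σ).choose, m

variable {𝓜}

theorem genSum_mem (σ : 𝓜.fan.Cone) : 𝓜.genSum σ ∈ 𝓜.S σ :=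
  sum_mem fun m hm => by
    have := (𝓜.fg σ).choose_spec
    exact this ▸ AddSubmonoid.subset_closure hm

/-- `genSum σ` is an order unit of `S_σ`: each generator is one of its summands. -/
theorem exists_add_eq_nsmul_genSum {σ : 𝓜.fan.Cone} {m : M} (hm : m ∈ 𝓜.S σ) :
    ∃ n : ℕ, ∃ m' ∈ 𝓜.S σ, m + m' = n • 𝓜.genSum σ := by
  classical
  have h := (𝓜.fg σ).choose_spec
  rw [← h] at hm
  induction hm using AddSubmonoid.closure_induction with
  | mem m hm =>
    refine ⟨1, ∑ x ∈ (𝓜.fg σ).choose.erase m, x, sum_mem fun x hx => ?_, ?_⟩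
    · rw [← h]
      exact AddSubmonoid.subset_closure (Finset.mem_of_mem_erase hx)
    · rw [one_smul, genSum, Finset.add_sum_erase _ (fun x => x) hm]
  | zero => exact ⟨0, 0, zero_mem _, by simp⟩
  | add a b _ _ ha hb =>
    obtain ⟨n, a', ha', ha⟩ := ha
    obtain ⟨n', b', hb', hb⟩ := hb
    refine ⟨n + n', a' + b', add_mem ha' hb', ?_⟩
    rw [add_smul, ← ha, ← hb]
    abel

theorem exists_nsmul_genSum_sub_mem {σ : 𝓜.fan.Cone} {x : ℝ ⊗[ℤ] M} (hx : x ∈ σ.1) :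
    ∃ n : ℕ, n • latticeMap M (𝓜.genSum σ) - x ∈ σ.1 := by
  have hu := latticeMap_mem (genSum_mem σ)
  rw [← 𝓜.hull_eq σ] at hx
  induction hx using Submodule.span_induction with
  | mem x hx =>
    obtain ⟨m, hm, rfl⟩ := hx
    obtain ⟨n, m', hm', h⟩ := exists_add_eq_nsmul_genSum hm
    refine ⟨n, ?_⟩
    rw [← map_nsmul, ← h, map_add, add_sub_cancel_left]
    exact latticeMap_mem hm'
  | zero => exact ⟨0, by simp⟩
  | add x y _ _ hx hy =>
    obtain ⟨n, hx⟩ := hx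
    obtain ⟨n', hy⟩ := hy
    refine ⟨n + n', ?_⟩
    convert add_mem hx hy using 1
    rw [add_smul]; abel
  | smul c x _ hx =>
    obtain ⟨n, hx⟩ := hx
    obtain ⟨N, hN⟩ := exists_nat_ge ((c : ℝ) * n)
    refine ⟨N, ?_⟩
    convert add_mem (Submodule.smul_mem _ c hx) (PointedCone.smul_mem _ (sub_nonneg.2 hN) hu)
      using 1
    rw [← Nat.cast_smul_eq_nsmul ℝ, ← Nat.cast_smul_eq_nsmul ℝ]
    change (N : ℝ) • _ - (c : ℝ) • x = (c : ℝ) • ((n : ℝ) • latticeMap M (𝓜.genSum σ) - x) + _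
    module

theorem S_mono {σ τ : 𝓜.fan.Cone} (h : σ ≤ τ) : 𝓜.S σ ≤ 𝓜.S τ := fun _ hm =>
  mem_of_latticeMap_mem hm (h (latticeMap_mem hm))

theorem Λ_mono {σ τ : 𝓜.fan.Cone} (h : σ ≤ τ) : 𝓜.Λ σ ≤ 𝓜.Λ τ :=
  AddSubgroup.closure_mono (S_mono h)

theorem S_le_Λ {σ : 𝓜.fan.Cone} {m : M} (h : m ∈ 𝓜.S σ) : m ∈ 𝓜.Λ σ :=
  AddSubgroup.subset_closure h

theorem mem_Λ {σ : 𝓜.fan.Cone} {m : M} : m ∈ 𝓜.Λ σ ↔ ∃ a ∈ 𝓜.S σ, ∃ b ∈ 𝓜.S σ, m = a - b := by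
  constructor
  · intro h
    induction h using AddSubgroup.closure_induction with
    | mem m hm => exact ⟨m, hm, 0, zero_mem _, by simp⟩
    | zero => exact ⟨0, zero_mem _, 0, zero_mem _, by simp⟩
    | add x y _ _ hx hy =>
      obtain ⟨a, ha, b, hb, rfl⟩ := hx
      obtain ⟨a', ha', b', hb', rfl⟩ := hy
      exact ⟨a + a', add_mem ha ha', b + b', add_mem hb hb', by abel⟩
    | neg x _ hx =>
      obtain ⟨a, ha, b, hb, rfl⟩ := hx
      exact ⟨b, hb, a, ha, by abel⟩
  · rintro ⟨a, ha, b, hb, rfl⟩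
    exact sub_mem (S_le_Λ ha) (S_le_Λ hb)

/-- Every point of `σ` is a summand in `σ` of a multiple of `genSum σ`, so a face of `σ` containing
`genSum σ` is all of `σ`. -/
theorem le_of_latticeMap_genSum_mem {σ τ : 𝓜.fan.Cone} (h : latticeMap M (𝓜.genSum σ) ∈ τ.1) :
    σ ≤ τ := by
  intro x hx
  obtain ⟨n, hn⟩ := exists_nsmul_genSum_sub_mem hx
  have hf := 𝓜.fan.inf_isFaceOf_left _ σ.2 _ τ.2
  refine (hf.mem_of_add_mem_left hx hn ?_).2
  rw [add_sub_cancel]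
  exact nsmul_mem (show _ ∈ σ.1 ⊓ τ.1 from ⟨latticeMap_mem (genSum_mem σ), h⟩) n

theorem genSum_mem_iff {σ τ : 𝓜.fan.Cone} : 𝓜.genSum σ ∈ 𝓜.S τ ↔ σ ≤ τ :=
  ⟨fun h => le_of_latticeMap_genSum_mem (latticeMap_mem h), fun h => S_mono h (genSum_mem σ)⟩

/-- If `v + u_σ` lies in the cone `τ`, with `v` and `u_σ` in a common cone, then `v ∈ S_τ` and
`σ ≤ τ`. -/
theorem mem_and_le_of_add_genSum_mem {σ τ ρ : 𝓜.fan.Cone} {v : M} (hv : v ∈ 𝓜.S ρ) (hσ : σ ≤ ρ)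
    (h : latticeMap M (v + 𝓜.genSum σ) ∈ τ.1) : v ∈ 𝓜.S τ ∧ σ ≤ τ := by
  have hu := S_mono hσ (genSum_mem σ)
  have h1 := mem_of_latticeMap_mem (add_mem hv hu) h
  refine ⟨mem_of_add_mem hv hu h1, genSum_mem_iff.1 (mem_of_add_mem hu hv ?_)⟩
  rwa [add_comm]

/-- If `m` lies in the span of every cone strictly between `σ` and `F`, where `σ` has codimension at
least two in `F`, then it lies in the span of `σ`. -/
theorem exists_add_nsmul_genSum_mem [Module.Finite ℤ M] {σ F : 𝓜.fan.Cone} (h : σ ≤ F)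
    (hdim : coneDim σ.1 + 2 ≤ coneDim F.1) {m : M}
    (hm : ∀ ρ, σ < ρ → ρ ≤ F → m ∈ 𝓜.Λ ρ) :
    ∃ n : ℕ, latticeMap M (m + n • 𝓜.genSum σ) ∈ σ.1 := by
  have key : ∀ m : M, (∀ ρ, σ < ρ → ρ ≤ F → m ∈ 𝓜.Λ ρ) →
      ∃ f ∈ F.1, ∃ b ∈ σ.1, latticeMap M m = f - b := by
    intro m hm
    by_contra! hcon
    obtain ⟨ρ, h1, h2, l, -, h4, h5⟩ := exists_lt_separating h hdim hcon
    obtain ⟨a, ha, b, hb, rfl⟩ := mem_Λ.1 (hm ρ h1 h2)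
    rw [map_sub, map_sub, h4 _ (latticeMap_mem ha), h4 _ (latticeMap_mem hb)] at h5
    simp at h5
  obtain ⟨f, hf, b, hb, h1⟩ := key m hm
  -- Using both signs, `m = f - b` and `-m = f' - b'` give `f + f' = b + b' ∈ σ`, and the face
  -- property puts `f` in `σ`.
  obtain ⟨f', hf', b', hb', h2⟩ := key (-m) fun ρ h1 h2 => neg_mem (hm ρ h1 h2)
  have hfσ : f ∈ σ.1 := by
    refine (isFaceOf_of_le h).mem_of_add_mem_left hf hf' ?_
    have : f + f' = b + b' := by
      rw [map_neg, h1] at h2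
      rw [← sub_eq_zero, ← sub_eq_zero.2 h2.symm]; abel
    rw [this]
    exact add_mem hb hb'
  obtain ⟨n, hn⟩ := exists_nsmul_genSum_sub_mem hb
  refine ⟨n, ?_⟩
  convert add_mem hfσ hn using 1
  rw [map_add, map_nsmul, h1]
  abel

variable [Module.Free ℤ M] [Module.Finite ℤ M]

theorem exists_nsmul_mem_S {σ : 𝓜.fan.Cone} {m : M} (h : latticeMap M m ∈ σ.1) :
    ∃ j : ℕ, 0 < j ∧ j • m ∈ 𝓜.S σ :=
  exists_nsmul_mem_of_latticeMap_mem_hull _ (𝓜.fg σ) _ (by rwa [𝓜.hull_eq])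

/-- In a seminormal complex, lattice points in the relative interior of `σ` lie in `S_σ`. -/
theorem mem_S_of_seminormal (hsn : ∀ (σ : 𝓜.fan.Cone) (m : M), 2 • m ∈ 𝓜.S σ → 3 • m ∈ 𝓜.S σ →
    m ∈ 𝓜.S σ) {σ : 𝓜.fan.Cone} {m : M} (hm : m ∈ 𝓜.Λ σ) {c : ℝ}
    (hσ : latticeMap M m ∈ σ.1)
    (hc : c • latticeMap M m - latticeMap M (𝓜.genSum σ) ∈ σ.1) : m ∈ 𝓜.S σ := by
  obtain ⟨N, hN0, hN⟩ : ∃ N : ℕ, 0 < N ∧ c ≤ N := by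
    obtain ⟨N, hN⟩ := exists_nat_ge c
    exact ⟨N + 1, N.succ_pos, hN.trans (by simp)⟩
  have h1 : latticeMap M (N • m - 𝓜.genSum σ) ∈ σ.1 := by
    convert add_mem hc (PointedCone.smul_mem _ (sub_nonneg.2 hN) hσ) using 1
    rw [map_sub, map_nsmul, ← Nat.cast_smul_eq_nsmul ℝ]
    module
  obtain ⟨j, hj, hs⟩ := exists_nsmul_mem_S h1
  obtain ⟨a, ha, b, hb, hab⟩ := mem_Λ.1 hm
  obtain ⟨n, b', hb', hn⟩ := exists_add_eq_nsmul_genSum (nsmul_mem hb (j * N + 1))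
  -- all large multiples of `m` lie in `S_σ`
  have hu := genSum_mem σ
  have large : ∀ t : ℕ, n * (j * N + 1) ≤ t → t • m ∈ 𝓜.S σ := by
    intro t ht
    have h0 : 0 < j * N := Nat.mul_pos hj hN0
    set K := j * N with hK
    set q := t / K
    set r := t % K
    have ht' : t = q * K + r := (Nat.div_add_mod' t K).symm
    have hr : r < K := Nat.mod_lt _ h0
    have hq : n ≤ q * j := by
      have h3 : n * K < (q + 1) * K := by nlinarith
      have : n < q + 1 := lt_of_mul_lt_mul_right h3 (Nat.zero_le _)
      nlinarith
    obtain ⟨p, hp⟩ := Nat.exists_eq_add_of_le hq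
    obtain ⟨e, he⟩ := Nat.exists_eq_add_of_le (show r ≤ K + 1 by omega)
    -- Write `t = qK + r` with `m = a - b`. The first term uses up `q * j` copies less of `genSum
    -- σ`, and `n` of those copies absorb the negative term `-r • b`, since `n • genSum σ = (K + 1)
    -- • b + b'` and `r ≤ K + 1`.
    have : t • m = q • (j • (N • m - 𝓜.genSum σ)) + p • 𝓜.genSum σ + r • a + b' + e • b := by
      have e1 : t • m = q • (j • (N • m)) + r • m := by
        rw [ht', add_smul, hK, mul_smul, mul_smul]
      have e2 : q • (j • 𝓜.genSum σ) = (r • b + e • b + b') + p • 𝓜.genSum σ := by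
        rw [← mul_smul, hp, add_smul, ← hn, ← add_smul, ← he]
      rw [e1, smul_sub, smul_sub, e2, hab, smul_sub r]
      abel
    rw [this]
    exact add_mem (add_mem (add_mem (add_mem (nsmul_mem hs _) (nsmul_mem hu _))
      (nsmul_mem ha _)) hb') (nsmul_mem hb _)
  -- Seminormality is applied to `t • m`, whose double and triple are strictly larger multiples of
  -- `m`; descending reaches `t = 1`.
  have descend : ∀ d t : ℕ, n * (j * N + 1) ≤ t + d → 0 < t → t • m ∈ 𝓜.S σ := by
    intro d
    induction d with
    | zero => intro t ht _; exact large t ht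
    | succ d ih =>
      intro t ht ht0
      refine hsn σ _ ?_ ?_
      · rw [← mul_smul]; exact ih _ (by omega) (by omega)
      · rw [← mul_smul]; exact ih _ (by omega) (by omega)
  simpa using descend (n * (j * N + 1)) 1 (by omega) one_pos

end MonoidalComplex

/-! ### Depth one and two in local rings. -/

section Depth

open IsLocalRing RingTheory.Sequence
open scoped Pointwise

variable {B : Type*} [CommRing B]

theorem isSMulRegular_quotSMulTop_iff {x z : B} : IsSMulRegular (QuotSMulTop x B) z ↔
    ∀ a b, z * a = x * b → ∃ c, a = x * c := by
  change IsSMulRegular (B ⧸ (x • ⊤ : Submodule B B)) z ↔ _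
  rw [isSMulRegular_quotient_iff_mem_of_smul_mem]
  have hmem : ∀ a, a ∈ (x • ⊤ : Submodule B B) ↔ ∃ c, a = x * c := fun a => by
    rw [Submodule.mem_smul_pointwise_iff_exists]
    simp [eq_comm]
  simp only [hmem, smul_eq_mul]
  exact ⟨fun h a b hab => h a ⟨b, hab⟩, fun h a ⟨b, hab⟩ => h a b hab⟩

variable [IsLocalRing B]

theorem one_le_localRingDepth {x : B} (hx : x ∈ maximalIdeal B) (h : ∀ a, x * a = 0 → a = 0) :
    1 ≤ localRingDepth B := by
  refine le_iSup₂_of_le (f := fun (rs : List B) (_ : (∀ r ∈ rs, r ∈ maximalIdeal B) ∧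
    IsRegular B rs) => (rs.length : ℕ∞)) [x] ⟨by simpa using hx, ?_⟩ (by simp)
  rw [isRegular_iff_isWeaklyRegular_of_subset_maximalIdeal (by simpa using hx),
    isWeaklyRegular_singleton_iff]
  intro a b hab
  refine sub_eq_zero.1 (h _ ?_)
  rw [mul_sub, sub_eq_zero]
  exact hab

theorem two_le_localRingDepth {x z : B} (hx : x ∈ maximalIdeal B) (hz : z ∈ maximalIdeal B)
    (hxreg : ∀ a, x * a = 0 → a = 0) (hzreg : ∀ a b, z * a = x * b → ∃ c, a = x * c) :
    2 ≤ localRingDepth B := by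
  have hmem : ∀ r ∈ [x, z], r ∈ maximalIdeal B := by
    intro r hr
    rcases List.mem_pair.1 hr with rfl | rfl
    exacts [hx, hz]
  refine le_iSup₂_of_le (f := fun (rs : List B) (_ : (∀ r ∈ rs, r ∈ maximalIdeal B) ∧
    IsRegular B rs) => (rs.length : ℕ∞)) [x, z] ⟨hmem, ?_⟩ (by simp)
  rw [isRegular_iff_isWeaklyRegular_of_subset_maximalIdeal hmem, isWeaklyRegular_cons_iff,
    isWeaklyRegular_singleton_iff, isSMulRegular_quotSMulTop_iff]
  refine ⟨fun a b hab => sub_eq_zero.1 (hxreg _ ?_), hzreg⟩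
  rw [mul_sub, sub_eq_zero]
  exact hab

theorem exists_of_two_le_localRingDepth (h : 2 ≤ localRingDepth B) :
    ∃ x ∈ maximalIdeal B, ∃ z ∈ maximalIdeal B, (∀ a, x * a = 0 → a = 0) ∧
      ∀ a b, z * a = x * b → ∃ c, a = x * c := by
  by_contra hcon
  have : localRingDepth B ≤ 1 := by
    refine iSup₂_le fun rs hrs => ?_
    match rs, hrs with
    | [], _ => simp
    | [_], _ => simp
    | x :: z :: rs, hrs =>
      refine (hcon ⟨x, hrs.1 x (by simp), z, hrs.1 z (by simp), ?_⟩).elim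
      have h1 := hrs.2.toIsWeaklyRegular
      rw [isWeaklyRegular_cons_iff, isWeaklyRegular_cons_iff, isSMulRegular_quotSMulTop_iff] at h1
      refine ⟨fun a ha => h1.1 ?_, h1.2.1⟩
      simpa using ha
  exact absurd (h.trans this) (by decide)

/-- In a local ring of depth at least two, `𝔪 y ⊆ (x)` implies `y ∈ (x)`, for `x` regular. -/
theorem exists_eq_mul_of_two_le_localRingDepth (h : 2 ≤ localRingDepth B) {x y : B}
    (hx : ∀ a, x * a = 0 → a = 0) (hy : ∀ w ∈ maximalIdeal B, ∃ c, w * y = x * c) :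
    ∃ c, y = x * c := by
  obtain ⟨u, hu, v, hv, hureg, hvreg⟩ := exists_of_two_le_localRingDepth h
  -- With `u, v` a regular sequence, `u y = x a` and `v y = x b` give `v a = u b`, so `a = u c`, and
  -- cancelling `u` leaves `y = x c`.
  obtain ⟨a, ha⟩ := hy u hu
  obtain ⟨b, hb⟩ := hy v hv
  obtain ⟨c, rfl⟩ := hvreg a b (by
    refine sub_eq_zero.1 (hx _ ?_)
    linear_combination u * hb - v * ha)
  refine ⟨c, sub_eq_zero.1 (hureg _ ?_)⟩
  linear_combination ha

/-- A factorial local ring of dimension at least two has depth at least two. -/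
theorem two_le_localRingDepth_of_uniqueFactorizationMonoid [IsDomain B]
    [UniqueFactorizationMonoid B] (h : 2 ≤ ringKrullDim B) : 2 ≤ localRingDepth B := by
  obtain ⟨l, hl⟩ := Order.le_krullDim_iff.1 (show ((2 : ℕ) : WithBot ℕ∞) ≤ _ from h)
  let q : PrimeSpectrum B := l ⟨1, by omega⟩
  have h0 : l ⟨0, by omega⟩ < q := l.strictMono (by simp [Fin.lt_def])
  have h2 : q < l ⟨2, by omega⟩ := l.strictMono (by simp [Fin.lt_def])
  have hq : q.asIdeal ≠ ⊥ := fun e => by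
    have := PrimeSpectrum.asIdeal_lt_asIdeal _ _ |>.2 h0
    rw [e] at this
    exact not_lt_bot this
  -- The middle prime `q` of the chain contains a prime element `x`; an element `z` of the top prime
  -- outside `q` is not divisible by `x`, so `x, z` is a regular sequence.
  obtain ⟨x, hx, hxp⟩ := q.isPrime.exists_mem_prime_of_ne_bot hq
  obtain ⟨z, hz, hzq⟩ := SetLike.exists_of_lt (PrimeSpectrum.asIdeal_lt_asIdeal _ _ |>.2 h2)
  refine two_le_localRingDepth (le_maximalIdeal q.isPrime.ne_top hx)
    (le_maximalIdeal (l ⟨2, by omega⟩).isPrime.ne_top hz)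
    (fun a ha => (mul_eq_zero.1 ha).resolve_left hxp.ne_zero) fun a b hab => ?_
  rcases hxp.dvd_or_dvd ⟨b, hab⟩ with ⟨c, hc⟩ | h
  · exact (hzq (hc ▸ q.asIdeal.mul_mem_right c hx)).elim
  · exact h

end Depth

/-! ### Depth two of a localization, in terms of the original ring. -/

section AtPrime

open IsLocalRing
open scoped Pointwise

variable {A : Type*} [CommRing A] (p : Ideal A) [p.IsPrime]

theorem algebraMap_atPrime_regular {x : A} (hx : ∀ a, x * a = 0 → a = 0)
    (b : Localization.AtPrime p) (hb : algebraMap A _ x * b = 0) : b = 0 := by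
  obtain ⟨a, s, rfl⟩ := IsLocalization.exists_mk'_eq p.primeCompl b
  rw [← IsLocalization.mk'_one (M := p.primeCompl), ← IsLocalization.mk'_mul,
    IsLocalization.mk'_eq_zero_iff] at hb
  obtain ⟨t, ht⟩ := hb
  rw [IsLocalization.mk'_eq_zero_iff]
  exact ⟨t, hx _ (by linear_combination ht)⟩

theorem exists_eq_algebraMap_mul_iff {x y : A} :
    (∃ c : Localization.AtPrime p, algebraMap A _ y = algebraMap A _ x * c) ↔
      ∃ s ∉ p, x ∣ s * y := by
  constructor
  · rintro ⟨c, hc⟩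
    obtain ⟨a, s, rfl⟩ := IsLocalization.exists_mk'_eq p.primeCompl c
    have h1 : algebraMap A (Localization.AtPrime p) (s * y) = algebraMap A _ (x * a) := by
      rw [map_mul, map_mul, hc, mul_left_comm, IsLocalization.mk'_spec'_mk]
    obtain ⟨t, ht⟩ := (IsLocalization.eq_iff_exists p.primeCompl _).1 h1
    exact ⟨t * s, (t * s).2, t * a, by linear_combination ht⟩
  · rintro ⟨s, hs, a, ha⟩
    have hu := IsLocalization.map_units (Localization.AtPrime p) (⟨s, hs⟩ : p.primeCompl)
    refine ⟨IsLocalization.mk' _ a (⟨s, hs⟩ : p.primeCompl), hu.mul_left_cancel ?_⟩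
    rw [mul_left_comm, IsLocalization.mk'_spec', ← map_mul, ← map_mul]
    exact congrArg _ ha

/-- `exists_eq_mul_of_two_le_localRingDepth` with denominators cleared. -/
theorem exists_dvd_of_two_le_localRingDepth (h : 2 ≤ localRingDepth (Localization.AtPrime p))
    {x y : A} (hx : ∀ a, x * a = 0 → a = 0) (hy : ∀ w ∈ p, x ∣ w * y) : ∃ s ∉ p, x ∣ s * y := by
  rw [← exists_eq_algebraMap_mul_iff]
  refine exists_eq_mul_of_two_le_localRingDepth h (algebraMap_atPrime_regular p hx) fun w hw => ?_
  obtain ⟨a, s, rfl⟩ := IsLocalization.exists_mk'_eq p.primeCompl w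
  replace hw := (IsLocalization.AtPrime.mk'_mem_maximal_iff _ p a s).1 hw
  obtain ⟨b, hb⟩ := hy a hw
  refine ⟨IsLocalization.mk' _ b s, ?_⟩
  rw [← IsLocalization.mk'_one (M := p.primeCompl), ← IsLocalization.mk'_mul,
    ← IsLocalization.mk'_one (M := p.primeCompl) _ x, ← IsLocalization.mk'_mul, hb]
  simp

/-- If depth two fails, no element of the maximal ideal is regular modulo `x`, so the maximal ideal
is an associated prime of `B/x`. The class it annihilates gives, after clearing denominators, a `y`
contradicting `h`. -/
theorem two_le_localRingDepth_atPrime [IsNoetherianRing A] {x : A} (hxp : x ∈ p)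
    (hx : ∀ a, x * a = 0 → a = 0)
    (h : ∀ y, (∀ w ∈ p, x ∣ w * y) → ∃ s ∉ p, x ∣ s * y) :
    2 ≤ localRingDepth (Localization.AtPrime p) := by
  set B := Localization.AtPrime p
  set x' := algebraMap A B x
  have hx' : x' ∈ maximalIdeal B := (IsLocalization.AtPrime.to_map_mem_maximal_iff B p x).2 hxp
  by_contra hcon
  have hz : ∀ z ∈ maximalIdeal B, ¬ IsSMulRegular (QuotSMulTop x' B) z := fun z hz hreg =>
    hcon (two_le_localRingDepth hx' hz (algebraMap_atPrime_regular p hx)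
      (isSMulRegular_quotSMulTop_iff.1 hreg))
  have hsub : (maximalIdeal B : Set B) ⊆
      ⋃ q ∈ associatedPrimes B (QuotSMulTop x' B), (q : Set B) := by
    rw [biUnion_associatedPrimes_eq_compl_regular]
    exact hz
  -- Prime avoidance among the finitely many associated primes.
  obtain ⟨q, hq, hle⟩ := (Ideal.subset_union_prime_finite (associatedPrimes.finite B _) ⊥ ⊥
    fun q hq _ _ => hq.isPrime).1 hsub
  have hqm : q = maximalIdeal B :=
    le_antisymm (le_maximalIdeal hq.isPrime.ne_top) hle
  obtain ⟨-, y, hy⟩ := isAssociatedPrime_iff.1 (AssociatedPrimes.mem_iff.1 hq)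
  obtain ⟨y, rfl⟩ := Submodule.Quotient.mk_surjective _ y
  obtain ⟨a, s, rfl⟩ := IsLocalization.exists_mk'_eq p.primeCompl y
  have hmem : ∀ b, b ∈ (x' • ⊤ : Submodule B B) ↔ ∃ c, b = x' * c := fun b => by
    rw [Submodule.mem_smul_pointwise_iff_exists]
    simp [eq_comm]
  have hcolon : ∀ w, w ∈ maximalIdeal B ↔ ∃ c, w * IsLocalization.mk' B a s = x' * c := by
    intro w
    rw [← hqm, hy, Submodule.mem_colon_singleton, Submodule.mem_bot, ← Submodule.Quotient.mk_smul,
      Submodule.Quotient.mk_eq_zero, hmem, smul_eq_mul]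
  have hcolon' : ∀ w : A, w ∈ p ↔ ∃ t ∉ p, x ∣ t * (w * a) := by
    intro w
    rw [← IsLocalization.AtPrime.to_map_mem_maximal_iff B p w, hcolon,
      ← exists_eq_algebraMap_mul_iff p]
    constructor
    · rintro ⟨c, hc⟩
      refine ⟨algebraMap A B s * c, ?_⟩
      rw [map_mul, mul_left_comm, ← hc, mul_left_comm, IsLocalization.mk'_spec']
    · rintro ⟨c, hc⟩
      have hu := IsLocalization.map_units B s
      refine ⟨IsLocalization.mk' B 1 s * c, hu.mul_left_cancel ?_⟩
      have h1 : algebraMap A B s * IsLocalization.mk' B 1 s = 1 := by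
        rw [IsLocalization.mk'_spec', map_one]
      have h2 : algebraMap A B s * IsLocalization.mk' B a s = algebraMap A B a :=
        IsLocalization.mk'_spec' _ _ _
      rw [map_mul] at hc
      linear_combination algebraMap A B w * h2 + hc - x' * c * h1
  -- Since `p` is finitely generated, one denominator `t` serves all of its elements.
  have hfg : ∃ t ∉ p, ∀ w ∈ p, x ∣ w * (t * a) := by
    classical
    obtain ⟨g, hg⟩ := IsNoetherian.noetherian p
    have : ∀ g' : Finset A, (g' : Set A) ⊆ p → ∃ t ∉ p, ∀ w ∈ g', x ∣ w * (t * a) := by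
      intro g'
      induction g' using Finset.induction_on with
      | empty => exact fun _ => ⟨1, p.one_notMem, by simp⟩
      | insert v g' _ ih =>
        intro hsub
        rw [Finset.coe_insert, Set.insert_subset_iff] at hsub
        obtain ⟨t, ht, h1⟩ := ih hsub.2
        obtain ⟨t', ht', h2⟩ := (hcolon' v).1 hsub.1
        refine ⟨t * t', ‹p.IsPrime›.mul_notMem ht ht', fun w hw => ?_⟩
        rcases Finset.mem_insert.1 hw with rfl | hw
        · exact (h2.mul_left t).trans (dvd_of_eq (by ring))
        · exact ((h1 w hw).mul_left t').trans (dvd_of_eq (by ring))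
    obtain ⟨t, ht, h1⟩ := this g (fun w hw => hg ▸ Submodule.subset_span hw)
    refine ⟨t, ht, fun w hw => ?_⟩
    rw [← hg] at hw
    induction hw using Submodule.span_induction with
    | mem w hw => exact h1 w hw
    | zero => simp
    | add v w _ _ hv hw => rw [add_mul]; exact dvd_add hv hw
    | smul c w _ hw => rw [smul_eq_mul, mul_assoc]; exact hw.mul_left c
  obtain ⟨t, ht, h1⟩ := hfg
  obtain ⟨s', hs', h2⟩ := h _ h1
  refine p.one_notMem ((hcolon' 1).2 ⟨s' * t, ‹p.IsPrime›.mul_notMem hs' ht, ?_⟩)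
  rwa [one_mul, mul_assoc]

end AtPrime

/-! ### The condition `S₂` in terms of heights. -/

section Serre

variable {A : Type*} [CommRing A]

theorem SatisfiesSerre.two_le_localRingDepth (h : SatisfiesSerre 2 A) (p : Ideal A) [hp : p.IsPrime]
    (hht : 2 ≤ p.height) : 2 ≤ localRingDepth (Localization.AtPrime p) := by
  have h1 := h ⟨p, hp⟩
  simp only [IsLocalization.AtPrime.ringKrullDim_eq_height p] at h1
  exact WithBot.coe_le_coe.1 ((le_min le_rfl (WithBot.coe_le_coe.2 hht)).trans h1)

theorem satisfiesSerre_two_of (h1 : ∀ (p : Ideal A) [p.IsPrime], 1 ≤ p.height →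
    1 ≤ localRingDepth (Localization.AtPrime p)) (h2 : ∀ (p : Ideal A) [p.IsPrime], 2 ≤ p.height →
    2 ≤ localRingDepth (Localization.AtPrime p)) : SatisfiesSerre 2 A := by
  intro ⟨p, hp⟩
  simp only [IsLocalization.AtPrime.ringKrullDim_eq_height p]
  by_cases h : 2 ≤ p.height
  · exact (min_le_left _ _).trans (WithBot.coe_le_coe.2 (h2 p h))
  · refine (min_le_right _ _).trans ?_
    by_cases h' : 1 ≤ p.height
    · have : p.height ≤ 1 := by
        simpa [one_add_one_eq_two, Order.lt_add_one_iff] using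
          ENat.lt_add_one_iff (by simp) |>.1 (show p.height < 1 + 1 by
            rw [one_add_one_eq_two]; exact not_le.1 h)
      exact WithBot.coe_le_coe.2 (this.trans (h1 p h'))
    · have : p.height = 0 := Order.lt_one_iff.1 (not_le.1 h')
      rw [this]
      exact WithBot.coe_le_coe.2 bot_le

theorem two_le_height {p q r : Ideal A} [p.IsPrime] [q.IsPrime] [r.IsPrime] (h : p < q)
    (h' : q < r) : 2 ≤ r.height := by
  have h1 := Ideal.height_add_one_le_of_lt_of_isPrime h
  have h2 := Ideal.height_add_one_le_of_lt_of_isPrime h'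
  calc (2 : ℕ∞) ≤ p.height + 1 + 1 := by rw [add_assoc, one_add_one_eq_two]; exact le_add_self
    _ ≤ q.height + 1 := by gcongr
    _ ≤ _ := h2

end Serre

/-! ### Group algebras of lattices are factorial. -/

section GroupAlgebra

variable (k : Type*) [Field k]

theorem twoUniqueSums_of_free (M : Type*) [AddCommGroup M] [Module.Free ℤ M] : TwoUniqueSums M :=
  TwoUniqueSums.of_injective_addHom (Module.Free.chooseBasis ℤ M).repr.toAddMonoidHom.toAddHom
    (Module.Free.chooseBasis ℤ M).repr.injective inferInstance

theorem isDomain_addMonoidAlgebra (M : Type*) [AddCommGroup M] [Module.Free ℤ M] :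
    IsDomain (AddMonoidAlgebra k M) :=
  have := twoUniqueSums_of_free M
  inferInstance

/-- Splitting off one coordinate gives a Laurent polynomial ring, a localization of a polynomial
ring over a factorial ring. -/
theorem uniqueFactorizationMonoid_addMonoidAlgebra_pi (n : ℕ) :
    UniqueFactorizationMonoid (AddMonoidAlgebra k (Fin n → ℤ)) := by
  induction n with
  | zero =>
    exact (AddMonoidAlgebra.uniqueRingEquiv (Fin 0 → ℤ)
      (R := k)).symm.toMulEquiv.uniqueFactorizationMonoid
      inferInstance
  | succ n ih =>
    have hd : IsDomain (AddMonoidAlgebra k (Fin n → ℤ)) := isDomain_addMonoidAlgebra k _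
    have h1 : UniqueFactorizationMonoid (LaurentPolynomial (AddMonoidAlgebra k (Fin n → ℤ))) :=
      UniqueFactorizationMonoid.of_isLocalization
        (Submonoid.powers (Polynomial.X : Polynomial (AddMonoidAlgebra k (Fin n → ℤ)))) _
    let e : (Fin (n + 1) → ℤ) ≃+ ℤ × (Fin n → ℤ) :=
      { (Fin.consEquiv fun _ => ℤ).symm with map_add' := fun _ _ => rfl }
    exact ((AddMonoidAlgebra.mapDomainRingEquiv k e).trans
      AddMonoidAlgebra.curryRingEquiv).symm.toMulEquiv.uniqueFactorizationMonoid h1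

theorem uniqueFactorizationMonoid_addMonoidAlgebra (M : Type*) [AddCommGroup M] [Module.Free ℤ M]
    [Module.Finite ℤ M] : UniqueFactorizationMonoid (AddMonoidAlgebra k M) :=
  (AddMonoidAlgebra.mapDomainRingEquiv k
    (Module.finBasis ℤ M).equivFun.toAddEquiv).symm.toMulEquiv.uniqueFactorizationMonoid
      (uniqueFactorizationMonoid_addMonoidAlgebra_pi k _)

end GroupAlgebra

/-! ### The toric face ring inside the product over its facets. -/

namespace MonoidalComplex

open RationalFan

variable {M : Type*} [AddCommGroup M]

/-- The facets of the fan of a monoidal complex. -/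
abbrev Facet (𝓜 : MonoidalComplex M) : Type _ := {F : 𝓜.fan.Cone // IsFacet F}

theorem Facet.eq_of_le {𝓜 : MonoidalComplex M} {F F' : 𝓜.Facet} (h : F.1 ≤ F'.1) : F = F' :=
  Subtype.ext (le_antisymm h (F.2 h))

theorem exists_facet_ge {𝓜 : MonoidalComplex M} (σ : 𝓜.fan.Cone) : ∃ F : 𝓜.Facet, σ ≤ F.1 := by
  obtain ⟨F, hF, h⟩ := exists_isFacet_ge σ
  exact ⟨⟨F, hF⟩, h⟩

/-- The condition for `(c_F χ^m)_F` to come from an element of the toric face ring. -/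
def Compatible {k : Type*} [Zero k] (𝓜 : MonoidalComplex M) (m : M) (c : 𝓜.Facet → k) : Prop :=
  (∀ F, c F ≠ 0 → m ∈ 𝓜.S F.1) ∧ ∀ F F' : 𝓜.Facet, m ∈ 𝓜.S F.1 → m ∈ 𝓜.S F'.1 → c F = c F'

namespace ToricFaceRing

variable {𝓜 : MonoidalComplex M} {k : Type*} [Field k]

/-- The restriction map `k[𝓜] → k[S_σ] ⊆ k[M]` as a ring homomorphism. -/
def restrHom (σ : 𝓜.fan.Cone) : 𝓜.ToricFaceRing k →+* AddMonoidAlgebra k M where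
  toFun := restr σ
  map_one' := restr_one σ
  map_mul' := restr_mul σ
  map_zero' := restr_zero σ
  map_add' := restr_add σ

theorem ext_restrHom {f g : 𝓜.ToricFaceRing k} (h : ∀ σ, restrHom σ f = restrHom σ g) : f = g :=
  ext_restr h

open Classical in
/-- The term `a χ^m`, which is `0` if `m` does not lie in the support. -/
def term (m : M) (a : k) : 𝓜.ToricFaceRing k :=
  if h : m ∈ 𝓜.support then ⟨Finsupp.single ⟨m, h⟩ a⟩ else 0

open Classical in
theorem restrHom_term (σ : 𝓜.fan.Cone) (m : M) (a : k) :
    restrHom σ (term m a) = if m ∈ 𝓜.S σ then AddMonoidAlgebra.single m a else 0 := by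
  unfold term
  split_ifs with h h' h'
  · exact (restrCoeff_single σ _ _).trans (if_pos h')
  · exact (restrCoeff_single σ _ _).trans (if_neg h')
  · exact (h ⟨σ, h'⟩).elim
  · exact map_zero _

theorem restrHom_term_of_mem {σ : 𝓜.fan.Cone} {m : M} (h : m ∈ 𝓜.S σ) (a : k) :
    restrHom σ (term m a) = AddMonoidAlgebra.single m a := by
  rw [restrHom_term, if_pos h]

theorem restrHom_term_of_notMem {σ : 𝓜.fan.Cone} {m : M} (h : m ∉ 𝓜.S σ) (a : k) :
    restrHom σ (term m a) = 0 := by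
  rw [restrHom_term, if_neg h]

theorem coeff_restrHom (σ : 𝓜.fan.Cone) (f : 𝓜.ToricFaceRing k) {m : M} (h : m ∈ 𝓜.S σ) :
    (restrHom σ f).coeff m = f.coeff ⟨m, σ, h⟩ :=
  coeff_restrCoeff σ ⟨m, σ, h⟩ h f.coeff

theorem coeff_restrHom_of_notMem (σ : 𝓜.fan.Cone) (f : 𝓜.ToricFaceRing k) {m : M}
    (h : m ∉ 𝓜.S σ) : (restrHom σ f).coeff m = 0 := by
  change (restrCoeff σ f.coeff).coeff m = 0
  classical
  induction f.coeff using Finsupp.induction_linear with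
  | zero => simp
  | add f g hf hg => simp [hf, hg]
  | single m' a =>
    rw [restrCoeff_single]
    split_ifs with h'
    · rw [AddMonoidAlgebra.coeff_single, Finsupp.single_apply, if_neg]
      rintro rfl
      exact h h'
    · simp

theorem ext_facet {f g : 𝓜.ToricFaceRing k} (h : ∀ F : 𝓜.Facet, restrHom F.1 f = restrHom F.1 g) :
    f = g := by
  refine coeffEquiv.injective (Finsupp.ext fun ⟨m, σ, hσ⟩ => ?_)
  obtain ⟨F, hF⟩ := exists_facet_ge σ
  have := congrArg (fun x : AddMonoidAlgebra k M => x.coeff m) (h F)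
  simp only [coeff_restrHom F.1 _ (S_mono hF hσ)] at this
  exact this

theorem term_mul_term {σ : 𝓜.fan.Cone} {m m' : M} (h : m ∈ 𝓜.S σ) (h' : m' ∈ 𝓜.S σ) (a b : k) :
    term m a * term m' b = (term (m + m') (a * b) : 𝓜.ToricFaceRing k) := by
  classical
  refine ext_restrHom fun τ => ?_
  rw [map_mul, restrHom_term, restrHom_term, restrHom_term]
  have hiff : m + m' ∈ 𝓜.S τ ↔ m ∈ 𝓜.S τ ∧ m' ∈ 𝓜.S τ :=
    ⟨fun h1 => ⟨mem_of_add_mem h h' h1, mem_of_add_mem h' h (add_comm m m' ▸ h1)⟩,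
      fun h1 => add_mem h1.1 h1.2⟩
  by_cases h1 : m ∈ 𝓜.S τ <;> by_cases h2 : m' ∈ 𝓜.S τ <;>
    simp [hiff, h1, h2, AddMonoidAlgebra.single_mul_single]

theorem term_mul_term_eq_zero {m m' : M} (h : ¬ ∃ σ, m ∈ 𝓜.S σ ∧ m' ∈ 𝓜.S σ) (a b : k) :
    term m a * term m' b = (0 : 𝓜.ToricFaceRing k) := by
  classical
  refine ext_restrHom fun τ => ?_
  rw [map_mul, restrHom_term, restrHom_term, map_zero]
  by_cases h1 : m ∈ 𝓜.S τ
  · rw [if_neg fun h2 => h ⟨τ, h1, h2⟩, mul_zero]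
  · rw [if_neg h1, zero_mul]

theorem term_zero (m : M) : (term m 0 : 𝓜.ToricFaceRing k) = 0 := by
  classical
  refine ext_restrHom fun τ => ?_
  rw [restrHom_term, map_zero]
  simp

theorem term_add (m : M) (a b : k) :
    (term m (a + b) : 𝓜.ToricFaceRing k) = term m a + term m b := by
  classical
  refine ext_restrHom fun τ => ?_
  rw [map_add, restrHom_term, restrHom_term, restrHom_term]
  split_ifs <;> simp

theorem one_eq_term : (1 : 𝓜.ToricFaceRing k) = term 0 1 := by
  refine ext_restrHom fun τ => ?_
  rw [map_one, restrHom_term_of_mem (zero_mem _)]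
  rfl

theorem term_eq_zero_of_notMem {m : M} (h : m ∉ 𝓜.support) (a : k) :
    (term m a : 𝓜.ToricFaceRing k) = 0 := dif_neg h

/-- The coefficients `k → k[𝓜]`. -/
def scalar (𝓜 : MonoidalComplex M) (k : Type*) [Field k] : k →+* 𝓜.ToricFaceRing k where
  toFun := term 0
  map_one' := one_eq_term.symm
  map_mul' a b := by
    obtain ⟨σ, hσ⟩ := 𝓜.fan.nonempty
    rw [term_mul_term (zero_mem (𝓜.S ⟨σ, hσ⟩)) (zero_mem _), add_zero]
  map_zero' := term_zero 0
  map_add' := term_add 0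

theorem scalar_mul_term (a b : k) (m : M) :
    scalar 𝓜 k a * term m b = term m (a * b) := by
  by_cases h : m ∈ 𝓜.support
  · obtain ⟨σ, h⟩ := h
    exact (term_mul_term (zero_mem _) h a b).trans (by rw [zero_add])
  · rw [term_eq_zero_of_notMem h, term_eq_zero_of_notMem h, mul_zero]

theorem eq_sum_term (f : 𝓜.ToricFaceRing k) :
    f = ∑ m ∈ f.coeff.support, term (m : M) (f.coeff m) := by
  classical
  refine ext_restrHom fun τ => ?_
  rw [map_sum]
  refine (restrCoeff_eq_sum τ f.coeff).trans (Finset.sum_congr rfl fun m _ => ?_)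
  simp only [restrHom_term]
  exact restrCoeff_single τ m _

variable (k) in
/-- The ideal of the cone `σ`, the kernel of `k[𝓜] → k[S_σ]`. -/
def coneIdeal (σ : 𝓜.fan.Cone) : Ideal (𝓜.ToricFaceRing k) := RingHom.ker (restrHom σ)

theorem mem_coneIdeal {σ : 𝓜.fan.Cone} {f : 𝓜.ToricFaceRing k} :
    f ∈ coneIdeal k σ ↔ restrHom σ f = 0 := Iff.rfl

theorem coneIdeal_eq_span (σ : 𝓜.fan.Cone) :
    coneIdeal k σ = Ideal.span {f | ∃ m ∈ 𝓜.support, m ∉ 𝓜.S σ ∧ f = term m 1} := by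
  refine le_antisymm (fun f hf => ?_) (Ideal.span_le.2 ?_)
  · rw [eq_sum_term f]
    refine sum_mem fun m hm => ?_
    rw [← mul_one (f.coeff m), ← scalar_mul_term]
    refine Ideal.mul_mem_left _ _ (Ideal.subset_span ⟨m, m.2, fun h => ?_, rfl⟩)
    rw [Finsupp.mem_support_iff] at hm
    refine hm ?_
    have := coeff_restrHom σ f h
    rw [mem_coneIdeal.1 hf] at this
    exact this.symm
  · rintro _ ⟨m, -, hm, rfl⟩
    exact restrHom_term_of_notMem hm 1

theorem term_mem_coneIdeal {σ : 𝓜.fan.Cone} {m : M} {a : k} (ha : a ≠ 0) :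
    term m a ∈ coneIdeal k σ ↔ m ∉ 𝓜.S σ := by
  refine ⟨fun h hm => ha ?_, fun h => restrHom_term_of_notMem h a⟩
  rw [mem_coneIdeal, restrHom_term_of_mem hm] at h
  exact AddMonoidAlgebra.single_eq_zero.1 h

theorem coneIdeal_anti {σ τ : 𝓜.fan.Cone} (h : σ ≤ τ) : coneIdeal k τ ≤ coneIdeal k σ := by
  rw [coneIdeal_eq_span τ, Ideal.span_le]
  rintro _ ⟨m, -, hm, rfl⟩
  exact restrHom_term_of_notMem (fun h' => hm (S_mono h h')) 1

theorem le_of_coneIdeal_le {σ τ : 𝓜.fan.Cone} (h : coneIdeal k τ ≤ coneIdeal k σ) : σ ≤ τ := by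
  by_contra hcon
  rw [← genSum_mem_iff] at hcon
  have := h ((term_mem_coneIdeal (one_ne_zero (α := k))).2 hcon)
  exact (term_mem_coneIdeal (one_ne_zero (α := k))).1 this (genSum_mem σ)

theorem coneIdeal_lt {σ τ : 𝓜.fan.Cone} (h : σ < τ) : coneIdeal k τ < coneIdeal k σ :=
  lt_of_le_not_ge (coneIdeal_anti h.le) fun h' => h.not_ge (le_of_coneIdeal_le h')

/-- The monomials of generators of all the `S_σ` generate `k[𝓜]` over `k`, so it is a quotient of a
polynomial ring in finitely many variables. -/
instance isNoetherianRing : IsNoetherianRing (𝓜.ToricFaceRing k) := by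
  classical
  let G : Set M := ⋃ σ : 𝓜.fan.Cone, ((𝓜.fg σ).choose : Set M)
  have hG : Finite G := (Set.finite_iUnion fun σ => Finset.finite_toSet _).to_subtype
  let φ : MvPolynomial G k →+* 𝓜.ToricFaceRing k :=
    MvPolynomial.eval₂Hom (scalar 𝓜 k) fun g => term (g : M) 1
  refine isNoetherianRing_of_surjective _ _ φ fun f => ?_
  rw [← RingHom.mem_range, eq_sum_term f]
  refine sum_mem fun m _ => ?_
  rw [← mul_one (f.coeff m), ← scalar_mul_term]
  refine mul_mem ⟨MvPolynomial.C _, MvPolynomial.eval₂Hom_C _ _ _⟩ ?_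
  obtain ⟨m, σ, hm⟩ := m
  have hσ := (𝓜.fg σ).choose_spec
  have : ∀ m ∈ AddSubmonoid.closure ((𝓜.fg σ).choose : Set M), m ∈ 𝓜.S σ ∧
      (term m 1 : 𝓜.ToricFaceRing k) ∈ φ.range := by
    intro m hm
    induction hm using AddSubmonoid.closure_induction with
    | mem m hm =>
      refine ⟨hσ ▸ AddSubmonoid.subset_closure hm,
        MvPolynomial.X ⟨m, Set.mem_iUnion.2 ⟨σ, hm⟩⟩, MvPolynomial.eval₂Hom_X' _ _ _⟩
    | zero => exact ⟨zero_mem _, one_eq_term (𝓜 := 𝓜) (k := k) ▸ one_mem _⟩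
    | add x y _ _ hx hy =>
      refine ⟨add_mem hx.1 hy.1, ?_⟩
      rw [← mul_one (1 : k), ← term_mul_term hx.1 hy.1]
      exact mul_mem hx.2 hy.2
  exact (this m (by rw [hσ]; exact hm)).2

variable (𝓜 k) in
/-- The embedding of `k[𝓜]` into the product of the rings `k[M]` over the facets. -/
def toPi : 𝓜.ToricFaceRing k →+* (𝓜.Facet → AddMonoidAlgebra k M) :=
  RingHom.pi fun F => restrHom F.1

theorem toPi_apply (f : 𝓜.ToricFaceRing k) (F : 𝓜.Facet) : toPi 𝓜 k f F = restrHom F.1 f := rfl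

theorem toPi_injective : Function.Injective (toPi 𝓜 k) := fun _ _ h =>
  ext_facet fun F => congrFun h F

theorem mem_range_toPi {b : 𝓜.Facet → AddMonoidAlgebra k M} :
    b ∈ (toPi 𝓜 k).range ↔ ∀ m, 𝓜.Compatible m fun F => (b F).coeff m := by
  classical
  constructor
  · rintro ⟨f, rfl⟩ m
    refine ⟨fun F h => ?_, fun F F' h h' => ?_⟩
    · by_contra hm
      exact h (coeff_restrHom_of_notMem F.1 f hm)
    · simp only [toPi_apply, coeff_restrHom F.1 f h, coeff_restrHom F'.1 f h']
  · intro h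
    let _ : Fintype 𝓜.Facet := Fintype.ofFinite _
    have hex : ∀ m : 𝓜.support, ∃ F : 𝓜.Facet, (m : M) ∈ 𝓜.S F.1 := by
      rintro ⟨m, σ, hm⟩
      obtain ⟨F, hF⟩ := exists_facet_ge σ
      exact ⟨F, S_mono hF hm⟩
    choose F hF using hex
    let T : Finset M := Finset.univ.biUnion fun F => (b F).coeff.support
    -- The coefficient at `m` is read off on any facet whose semigroup contains `m`; compatibility
    -- makes the choice immaterial.
    refine ⟨⟨Finsupp.onFinset (T.subtype (· ∈ 𝓜.support)) (fun m => (b (F m)).coeff m)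
      fun m hm => ?_⟩, ?_⟩
    · rw [Finset.mem_subtype]
      exact Finset.mem_biUnion.2 ⟨F m, Finset.mem_univ _, Finsupp.mem_support_iff.2 hm⟩
    · funext G
      refine AddMonoidAlgebra.coeff_injective (Finsupp.ext fun m => ?_)
      rw [toPi_apply]
      by_cases hm : m ∈ 𝓜.S G.1
      · rw [coeff_restrHom _ _ hm]
        exact (h m).2 _ _ (hF ⟨m, G.1, hm⟩) hm
      · rw [coeff_restrHom_of_notMem _ _ hm]
        by_contra hne
        exact hm ((h m).1 G fun h' => hne h'.symm)

open Classical in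
theorem toPi_term_mul_apply (v : M) (b : 𝓜.Facet → AddMonoidAlgebra k M) (F : 𝓜.Facet) (m : M) :
    ((toPi 𝓜 k (term v 1) * b) F).coeff (v + m) = if v ∈ 𝓜.S F.1 then (b F).coeff m else 0 := by
  rw [Pi.mul_apply, toPi_apply, restrHom_term]
  split_ifs
  · rw [AddMonoidAlgebra.coeff_single_mul_apply]
    simp
  · simp

open Classical in
-- Multiplication by `χ^v` shifts degrees by `v` on the facets with `v ∈ S_F` and kills the other
-- components, so the test can be made one degree at a time.
theorem toPi_term_mul_mem_range {v : M} {b : 𝓜.Facet → AddMonoidAlgebra k M} :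
    toPi 𝓜 k (term v 1) * b ∈ (toPi 𝓜 k).range ↔
      ∀ m, 𝓜.Compatible (v + m) fun F => if v ∈ 𝓜.S F.1 then (b F).coeff m else 0 := by
  rw [mem_range_toPi]
  constructor
  · intro h m
    simpa only [toPi_term_mul_apply] using h (v + m)
  · intro h m
    have := h (m - v)
    simp only [← toPi_term_mul_apply, add_sub_cancel] at this
    exact this

/-- Multiplying by the ideal of `σ` can be tested on monomials. -/
theorem coneIdeal_mul_mem_range {σ : 𝓜.fan.Cone} {b : 𝓜.Facet → AddMonoidAlgebra k M}
    (h : ∀ v ∈ 𝓜.support, v ∉ 𝓜.S σ → toPi 𝓜 k (term v 1) * b ∈ (toPi 𝓜 k).range) :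
    ∀ w ∈ coneIdeal k σ, toPi 𝓜 k w * b ∈ (toPi 𝓜 k).range := by
  intro w hw
  rw [coneIdeal_eq_span] at hw
  induction hw using Submodule.span_induction with
  | mem w hw =>
    obtain ⟨m, hm, hmσ, rfl⟩ := hw
    exact h m hm hmσ
  | zero => simp
  | add v w _ _ hv hw => rw [map_add, add_mul]; exact add_mem hv hw
  | smul c w _ hw => rw [smul_eq_mul, map_mul, mul_assoc]; exact mul_mem ⟨c, rfl⟩ hw

open Classical in
variable (𝓜 k) in
/-- A nonzerodivisor which restricts to a monomial on every facet. -/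
def facetSum : 𝓜.ToricFaceRing k := ∑ F : 𝓜.Facet, term (𝓜.genSum F.1) 1

theorem restrHom_facetSum (F : 𝓜.Facet) :
    restrHom F.1 (facetSum 𝓜 k) = AddMonoidAlgebra.single (𝓜.genSum F.1) 1 := by
  classical
  rw [facetSum, map_sum, Finset.sum_eq_single F]
  · exact restrHom_term_of_mem (genSum_mem _) 1
  · intro F' _ hne
    exact restrHom_term_of_notMem (fun h => hne (Facet.eq_of_le (genSum_mem_iff.1 h))) 1
  · simp

theorem facetSum_mem {σ : 𝓜.fan.Cone} (hσ : ¬ IsFacet σ) : facetSum 𝓜 k ∈ coneIdeal k σ := by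
  classical
  refine sum_mem fun F _ => (term_mem_coneIdeal one_ne_zero).2 fun h => hσ ?_
  have hle := genSum_mem_iff.1 h
  have : σ = F.1 := le_antisymm (F.2 hle) hle
  exact this ▸ F.2

variable [Module.Free ℤ M]

instance coneIdeal_isPrime (σ : 𝓜.fan.Cone) : (coneIdeal k σ).IsPrime :=
  have := isDomain_addMonoidAlgebra k M
  RingHom.ker_isPrime _

theorem eq_zero_of_mul_eq_zero {x : 𝓜.ToricFaceRing k} (hx : ∀ F : 𝓜.Facet, restrHom F.1 x ≠ 0)
    (a : 𝓜.ToricFaceRing k) (h : x * a = 0) : a = 0 := by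
  have := isDomain_addMonoidAlgebra k M
  refine ext_facet fun F => ?_
  have h1 := congrArg (restrHom F.1) h
  rw [map_mul, map_zero] at h1
  rw [map_zero]
  exact (mul_eq_zero.1 h1).resolve_left (hx F)

theorem facetSum_mul_eq_zero (a : 𝓜.ToricFaceRing k) (h : facetSum 𝓜 k * a = 0) : a = 0 :=
  eq_zero_of_mul_eq_zero (fun F => by
    rw [restrHom_facetSum]
    exact AddMonoidAlgebra.single_ne_zero.2 one_ne_zero) a h

/-- With `x = facetSum`, the element `y = x b` satisfies `p y ⊆ (x)`, so depth two gives `s y ∈ (x)`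
for some `s ∉ p`; cancelling `x`, a nonzero monomial on each facet, gives the claim for `b`. -/
theorem exists_mul_mem_range_of_two_le_depth (p : Ideal (𝓜.ToricFaceRing k)) [p.IsPrime]
    (hx : facetSum 𝓜 k ∈ p) (h : 2 ≤ localRingDepth (Localization.AtPrime p))
    {b : 𝓜.Facet → AddMonoidAlgebra k M} (hb : ∀ w ∈ p, toPi 𝓜 k w * b ∈ (toPi 𝓜 k).range) :
    ∃ s ∉ p, toPi 𝓜 k s * b ∈ (toPi 𝓜 k).range := by
  have := isDomain_addMonoidAlgebra k M
  obtain ⟨y, hy⟩ := hb _ hx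
  obtain ⟨s, hs, a, ha⟩ := exists_dvd_of_two_le_localRingDepth p h facetSum_mul_eq_zero (y := y)
    fun w hw => by
      obtain ⟨c, hc⟩ := hb w hw
      refine ⟨c, toPi_injective ?_⟩
      rw [map_mul, map_mul, hy, hc]
      ring
  refine ⟨s, hs, a, ?_⟩
  funext F
  have h1 : restrHom F.1 (facetSum 𝓜 k) * restrHom F.1 a =
      restrHom F.1 (facetSum 𝓜 k) * (restrHom F.1 s * b F) := by
    rw [← map_mul, ← ha, map_mul]
    have := congrFun hy F
    rw [toPi_apply, Pi.mul_apply, toPi_apply] at this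
    rw [this]
    ring
  refine mul_left_cancel₀ ?_ h1
  rw [restrHom_facetSum]
  exact AddMonoidAlgebra.single_ne_zero.2 one_ne_zero

/-- Any `y` is `x b` with `x = facetSum` and `b = y / x` in the product, because `x` is invertible
there. Divisibility by `x` then becomes membership in `k[𝓜]`. -/
theorem two_le_depth_of_exists_mul_mem_range (p : Ideal (𝓜.ToricFaceRing k)) [p.IsPrime]
    (hx : facetSum 𝓜 k ∈ p)
    (h : ∀ b : 𝓜.Facet → AddMonoidAlgebra k M, (∀ w ∈ p, toPi 𝓜 k w * b ∈ (toPi 𝓜 k).range) →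
      ∃ s ∉ p, toPi 𝓜 k s * b ∈ (toPi 𝓜 k).range) :
    2 ≤ localRingDepth (Localization.AtPrime p) := by
  refine two_le_localRingDepth_atPrime p hx facetSum_mul_eq_zero fun y hy => ?_
  let b : 𝓜.Facet → AddMonoidAlgebra k M := fun F =>
    AddMonoidAlgebra.single (-𝓜.genSum F.1) 1 * restrHom F.1 y
  have hb : toPi 𝓜 k (facetSum 𝓜 k) * b = toPi 𝓜 k y := by
    funext F
    rw [Pi.mul_apply, toPi_apply, restrHom_facetSum, toPi_apply, ← mul_assoc,
      AddMonoidAlgebra.single_mul_single, add_neg_cancel, mul_one, ← AddMonoidAlgebra.one_def,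
      one_mul]
  have hunit : ∀ b b' : 𝓜.Facet → AddMonoidAlgebra k M,
      toPi 𝓜 k (facetSum 𝓜 k) * b = toPi 𝓜 k (facetSum 𝓜 k) * b' → b = b' := by
    intro b b' h
    have := isDomain_addMonoidAlgebra k M
    funext F
    refine mul_left_cancel₀ ?_ (congrFun h F)
    rw [toPi_apply, restrHom_facetSum]
    exact AddMonoidAlgebra.single_ne_zero.2 one_ne_zero
  obtain ⟨s, hs, a, ha⟩ := h b fun w hw => by
    obtain ⟨c, hc⟩ := hy w hw
    refine ⟨c, hunit _ _ ?_⟩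
    rw [← map_mul, ← hc, map_mul, ← hb]
    ring
  refine ⟨s, hs, a, toPi_injective ?_⟩
  rw [map_mul, map_mul, ha, ← hb]
  ring

/-- The common root `a` of `χ^{2m}` and `χ^{3m}` satisfies `χ^{2m} a = χ^{3m}`, so it restricts to
`χ^m` on `σ`. -/
theorem mem_S_of_isSeminormalRing (h : IsSeminormalRing (𝓜.ToricFaceRing k)) (σ : 𝓜.fan.Cone)
    (m : M) (h2 : 2 • m ∈ 𝓜.S σ) (h3 : 3 • m ∈ 𝓜.S σ) : m ∈ 𝓜.S σ := by
  have := isDomain_addMonoidAlgebra k M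
  obtain ⟨a, ⟨ha2, ha3⟩, -⟩ := h (term (2 • m) 1) (term (3 • m) 1) (by
    have h6 := add_mem h2 h2
    rw [pow_succ, pow_two, pow_two, term_mul_term h2 h2, term_mul_term h6 h2, term_mul_term h3 h3]
    congr 1
    · module
    · simp)
  have e2 := congrArg (restrHom σ) ha2
  have e3 := congrArg (restrHom σ) ha3
  rw [restrHom_term_of_mem h2, map_pow] at e2
  rw [restrHom_term_of_mem h3, map_pow] at e3
  have : restrHom σ a = AddMonoidAlgebra.single m 1 := by
    have hne : (AddMonoidAlgebra.single (2 • m) 1 : AddMonoidAlgebra k M) ≠ 0 :=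
      AddMonoidAlgebra.single_ne_zero.2 one_ne_zero
    refine mul_left_cancel₀ hne ?_
    rw [AddMonoidAlgebra.single_mul_single, ← succ_nsmul, mul_one, e2, e3]
    ring
  by_contra hm
  have h0 := coeff_restrHom_of_notMem σ a hm
  rw [this] at h0
  simp at h0

end ToricFaceRing

end MonoidalComplex

/-! ### Prime ideals and the cones they determine. -/

namespace MonoidalComplex

open RationalFan

variable {M : Type*} [AddCommGroup M] {𝓜 : MonoidalComplex M} {k : Type*} [Field k]

theorem Compatible.zero (m : M) : 𝓜.Compatible m fun _ => (0 : k) :=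
  ⟨fun _ h => (h rfl).elim, fun _ _ _ _ => rfl⟩

/-- A summand of an element of `S_{F'}` lies in `S_{F'}`, so passing from `m` to `s + m` creates no
new coincidences between a facet with nonzero coefficient and another facet. -/
theorem Compatible.add_left {m s : M} {σ : 𝓜.fan.Cone} {c : 𝓜.Facet → k} (h : 𝓜.Compatible m c)
    (hs : s ∈ 𝓜.S σ) (hc : ∀ F, c F ≠ 0 → σ ≤ F.1) : 𝓜.Compatible (s + m) c := by
  have h1 : ∀ F, c F ≠ 0 → m ∈ 𝓜.S F.1 ∧ s ∈ 𝓜.S F.1 := fun F hF =>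
    ⟨h.1 F hF, S_mono (hc F hF) hs⟩
  have h2 : ∀ F F' : 𝓜.Facet, s + m ∈ 𝓜.S F'.1 → c F ≠ 0 → c F = c F' := by
    intro F F' hF' hcF
    refine h.2 F F' (h1 F hcF).1 (mem_of_add_mem (h1 F hcF).1 (h1 F hcF).2 ?_)
    rwa [add_comm]
  refine ⟨fun F hF => add_mem (h1 F hF).2 (h1 F hF).1, fun F F' hF hF' => ?_⟩
  by_cases h0 : c F = 0
  · by_cases h0' : c F' = 0
    · rw [h0, h0']
    · exact (h2 F' F hF h0').symm
  · exact h2 F F' hF' h0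

namespace ToricFaceRing

theorem term_nsmul_mul_term_nsmul (σ : 𝓜.fan.Cone) (n n' : ℕ) :
    term (n • 𝓜.genSum σ) 1 * term (n' • 𝓜.genSum σ) 1 =
      (term ((n + n') • 𝓜.genSum σ) 1 : 𝓜.ToricFaceRing k) := by
  rw [term_mul_term (nsmul_mem (genSum_mem σ) n) (nsmul_mem (genSum_mem σ) n'), mul_one, add_smul]

section

variable [Module.Free ℤ M] [Module.Finite ℤ M]

/-- Every prime ideal `p` of `k[𝓜]` determines a cone `σ` such that `χ^m ∉ p` if and only if
`m ∈ S_σ`. -/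
theorem exists_cone_of_isPrime (p : Ideal (𝓜.ToricFaceRing k)) [hp : p.IsPrime] :
    ∃ σ : 𝓜.fan.Cone, coneIdeal k σ ≤ p ∧ ∀ m ∈ 𝓜.S σ, (term m 1 : 𝓜.ToricFaceRing k) ∉ p := by
  classical
  let N : M → Prop := fun m => (term m 1 : 𝓜.ToricFaceRing k) ∉ p
  have hN0 : N 0 := by
    change term 0 1 ∉ p
    rw [← one_eq_term]
    exact p.one_notMem
  have hcommon : ∀ {m m'}, N m → N m' → ∃ σ, m ∈ 𝓜.S σ ∧ m' ∈ 𝓜.S σ := by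
    intro m m' h h'
    by_contra hcon
    refine hp.mul_notMem h h' ?_
    rw [term_mul_term_eq_zero hcon]
    exact zero_mem _
  have hadd : ∀ {m m'}, N m → N m' → N (m + m') := by
    intro m m' h h'
    obtain ⟨σ, h1, h2⟩ := hcommon h h'
    have := hp.mul_notMem h h'
    rwa [term_mul_term h1 h2, mul_one] at this
  have hleft : ∀ {τ : 𝓜.fan.Cone} {m m'}, m ∈ 𝓜.S τ → m' ∈ 𝓜.S τ → N (m + m') → N m := by
    intro τ m m' h h' hN hm
    refine hN ?_
    rw [← mul_one (1 : k), ← term_mul_term h h']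
    exact p.mul_mem_right _ hm
  have hsum : ∀ T : Finset M, (∀ g ∈ T, N g) → N (∑ g ∈ T, g) := by
    intro T
    induction T using Finset.induction_on with
    | empty => exact fun _ => by simpa using hN0
    | insert g T hg ih =>
      intro h
      rw [Finset.sum_insert hg]
      exact hadd (h g (Finset.mem_insert_self _ _))
        (ih fun x hx => h x (Finset.mem_insert_of_mem hx))
  -- The monomials outside `p` are closed under products and under divisors, so the generators among
  -- them determine them all. Their sum `w` is meant to be an interior point of the cone sought,
  -- which is taken minimal with `w ∈ S_σ`.
  let G : Finset M := (Finset.univ.biUnion fun σ : 𝓜.fan.Cone => (𝓜.fg σ).choose).filter N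
  let w : M := ∑ g ∈ G, g
  have hGN : ∀ g ∈ G, N g := fun g hg => (Finset.mem_filter.1 hg).2
  have hw : N w := hsum G hGN
  have hwsupp : w ∈ 𝓜.support := by
    by_contra h
    refine hw ?_
    rw [term_eq_zero_of_notMem h]
    exact zero_mem _
  obtain ⟨σ, hσ⟩ := (Set.toFinite {σ : 𝓜.fan.Cone | w ∈ 𝓜.S σ}).exists_minimal hwsupp
  have hwσ : w ∈ 𝓜.S σ := hσ.1
  have hgS : ∀ g ∈ G, g ∈ 𝓜.S σ := by
    intro g hg
    have h1 : w = g + ∑ x ∈ G.erase g, x := (Finset.add_sum_erase G (fun x => x) hg).symm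
    obtain ⟨τ, h2, h3⟩ := hcommon (hGN g hg)
      (hsum (G.erase g) fun x hx => hGN x (Finset.mem_of_mem_erase hx))
    exact mem_of_add_mem h2 h3 (h1 ▸ hwσ)
  have hsmul : ∀ {m} (n : ℕ), N m → N (n • m) := by
    intro m n h
    induction n with
    | zero => simpa using hN0
    | succ n ih => rw [succ_nsmul]; exact hadd ih h
  -- By minimality the smallest face of `σ` containing `w` is `σ` itself, so `genSum σ` is a summand
  -- of a multiple of `w`.
  have hu : N (𝓜.genSum σ) := by
    have hf := PointedCone.minFace_isFaceOf σ.1 (latticeMap M w)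
    let ρ : 𝓜.fan.Cone := ⟨_, 𝓜.fan.face_mem _ σ.2 _ hf⟩
    have h1 : w ∈ 𝓜.S ρ :=
      (𝓜.face σ ρ hf w).2 ⟨hwσ, PointedCone.self_mem_minFace (latticeMap_mem hwσ)⟩
    obtain ⟨-, c, -, hc⟩ := PointedCone.mem_minFace.1
      ((hσ.2 h1 (fun x hx => hx.1) : σ ≤ ρ) (latticeMap_mem (genSum_mem σ)))
    obtain ⟨n, hn⟩ := exists_nat_ge c
    have h2 : latticeMap M (n • w - 𝓜.genSum σ) ∈ σ.1 := by
      convert add_mem hc (PointedCone.smul_mem _ (sub_nonneg.2 hn) (latticeMap_mem hwσ)) using 1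
      rw [map_sub, map_nsmul, ← Nat.cast_smul_eq_nsmul ℝ]
      module
    obtain ⟨j, hj, hs⟩ := exists_nsmul_mem_S h2
    have h3 : (j * n) • w = 𝓜.genSum σ + ((j - 1) • 𝓜.genSum σ + j • (n • w - 𝓜.genSum σ)) := by
      obtain ⟨i, rfl⟩ : ∃ i, j = i + 1 := ⟨j - 1, by omega⟩
      rw [Nat.add_sub_cancel, mul_smul, smul_sub, ← add_assoc, ← succ_nsmul']
      abel
    refine hleft (genSum_mem σ) (add_mem (nsmul_mem (genSum_mem σ) (j - 1)) hs) ?_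
    rw [← h3]
    exact hsmul _ hw
  refine ⟨σ, ?_, fun m hm => ?_⟩
  · rw [coneIdeal_eq_span, Ideal.span_le]
    rintro _ ⟨v, ⟨τ, hv⟩, hvσ, rfl⟩
    by_contra hNv
    refine hvσ ?_
    have hτ := (𝓜.fg τ).choose_spec
    have key : ∀ v ∈ AddSubmonoid.closure ((𝓜.fg τ).choose : Set M),
        v ∈ 𝓜.S τ ∧ (N v → v ∈ 𝓜.S σ) := by
      intro v hv
      induction hv using AddSubmonoid.closure_induction with
      | mem g hg =>
        exact ⟨hτ ▸ AddSubmonoid.subset_closure hg, fun h => hgS g (Finset.mem_filter.2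
          ⟨Finset.mem_biUnion.2 ⟨τ, Finset.mem_univ _, hg⟩, h⟩)⟩
      | zero => exact ⟨zero_mem _, fun _ => zero_mem _⟩
      | add a b _ _ ha hb =>
        refine ⟨add_mem ha.1 hb.1, fun h => add_mem (ha.2 (hleft ha.1 hb.1 h))
          (hb.2 (hleft hb.1 ha.1 ?_))⟩
        rwa [add_comm]
    exact (key v (by rw [hτ]; exact hv)).2 hNv
  · obtain ⟨n, m', hm', h⟩ := exists_add_eq_nsmul_genSum hm
    refine hleft hm hm' ?_
    rw [h]
    exact hsmul n hu

theorem eq_coneIdeal_of_le (F : 𝓜.Facet) (q : Ideal (𝓜.ToricFaceRing k)) [q.IsPrime]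
    (h : q ≤ coneIdeal k F.1) : q = coneIdeal k F.1 := by
  obtain ⟨σ, hσ, -⟩ := exists_cone_of_isPrime q
  have hle := le_of_coneIdeal_le (hσ.trans h)
  have : σ = F.1 := le_antisymm (F.2 hle) hle
  exact le_antisymm h (this ▸ hσ)

theorem coneIdeal_mem_minimalPrimes (F : 𝓜.Facet) :
    coneIdeal k F.1 ∈ minimalPrimes (𝓜.ToricFaceRing k) :=
  ⟨⟨inferInstance, bot_le⟩, fun q hq hle => by
    have := hq.1
    exact (eq_coneIdeal_of_le F q hle).ge⟩

/-- The ideals `P_F` of the facets are minimal primes, so `p` lies in none of them; by prime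
avoidance it has an element outside them all, which is a nonzerodivisor. -/
theorem one_le_depth_atPrime (p : Ideal (𝓜.ToricFaceRing k)) [p.IsPrime] (h : 1 ≤ p.height) :
    1 ≤ localRingDepth (Localization.AtPrime p) := by
  have hnot : ∀ F : 𝓜.Facet, ¬ p ≤ coneIdeal k F.1 := by
    intro F hF
    have := Ideal.height_eq_zero_iff.2 (eq_coneIdeal_of_le F p hF ▸ coneIdeal_mem_minimalPrimes F)
    rw [this] at h
    simp at h
  obtain ⟨x, hxp, hx⟩ : ∃ x ∈ p, ∀ F : 𝓜.Facet, x ∉ coneIdeal k F.1 := by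
    by_contra! hcon
    have hsub : (p : Set (𝓜.ToricFaceRing k)) ⊆
        ⋃ F ∈ (Set.univ : Set 𝓜.Facet), (coneIdeal k F.1 : Set (𝓜.ToricFaceRing k)) := by
      intro x hx
      obtain ⟨F, hF⟩ := hcon x hx
      exact Set.mem_biUnion (Set.mem_univ F) hF
    obtain ⟨F0, -⟩ := exists_facet_ge (𝓜 := 𝓜) ⟨_, 𝓜.fan.nonempty.choose_spec⟩
    obtain ⟨F, -, hF⟩ := (Ideal.subset_union_prime_finite Set.finite_univ F0 F0
      fun F _ _ _ => inferInstance).1 hsub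
    exact hnot F hF
  exact one_le_localRingDepth ((IsLocalization.AtPrime.to_map_mem_maximal_iff _ p x).2 hxp)
    (algebraMap_atPrime_regular p (eq_zero_of_mul_eq_zero hx))

end

/-! ### Primes attached to facets. -/

section FacetLocalization

variable (𝓜 k) in
/-- The group algebra of `Λ_σ`, as a subring of `k[M]`. -/
def groupSubring (σ : 𝓜.fan.Cone) : Subring (AddMonoidAlgebra k M) :=
  (AddMonoidAlgebra.mapDomainRingHom k (𝓜.Λ σ).subtype).range

theorem single_mem_groupSubring {σ : 𝓜.fan.Cone} {m : M} (h : m ∈ 𝓜.Λ σ) (a : k) :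
    AddMonoidAlgebra.single m a ∈ groupSubring 𝓜 k σ :=
  ⟨AddMonoidAlgebra.single ⟨m, h⟩ a, by simp⟩

theorem restrHom_mem_groupSubring (σ : 𝓜.fan.Cone) (f : 𝓜.ToricFaceRing k) :
    restrHom σ f ∈ groupSubring 𝓜 k σ := by
  classical
  rw [eq_sum_term f, map_sum]
  refine sum_mem fun m _ => ?_
  rw [restrHom_term]
  split_ifs with h
  · exact single_mem_groupSubring (S_le_Λ h) _
  · exact zero_mem _

variable (k) in
/-- The restriction map `k[𝓜] → k[Λ_σ]`. -/
def restrGroup (σ : 𝓜.fan.Cone) : 𝓜.ToricFaceRing k →+* groupSubring 𝓜 k σ :=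
  (restrHom σ).codRestrict _ (restrHom_mem_groupSubring σ)

/-- For a facet `F`, the ring `k[Λ_F]` is the localization of `k[𝓜]` at a monomial. -/
theorem isLocalization_restrGroup (F : 𝓜.Facet) :
    letI := (restrGroup k F.1).toAlgebra
    IsLocalization (Submonoid.powers (term (𝓜.genSum F.1) 1 : 𝓜.ToricFaceRing k))
      (groupSubring 𝓜 k F.1) := by
  let _ := (restrGroup k F.1).toAlgebra
  set u := 𝓜.genSum F.1
  have hu : u ∈ 𝓜.S F.1 := genSum_mem F.1
  have hpow : ∀ n : ℕ, (term u 1 : 𝓜.ToricFaceRing k) ^ n = term (n • u) 1 := by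
    intro n
    induction n with
    | zero => rw [pow_zero, zero_smul, one_eq_term]
    | succ n ih =>
      rw [pow_succ, ih, term_mul_term (nsmul_mem hu n) hu, mul_one, succ_nsmul]
  have hval : ∀ f, ((algebraMap (𝓜.ToricFaceRing k) (groupSubring 𝓜 k F.1) f :
    groupSubring 𝓜 k F.1) : AddMonoidAlgebra k M) = restrHom F.1 f := fun f => rfl
  refine ⟨?_, ?_, ?_⟩
  · rintro ⟨_, n, rfl⟩
    refine IsUnit.of_mul_eq_one (M := groupSubring 𝓜 k F.1)
      ⟨AddMonoidAlgebra.single (-(n • u)) 1,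
        single_mem_groupSubring (neg_mem (nsmul_mem (S_le_Λ hu) n)) 1⟩ (Subtype.ext ?_)
    change restrHom F.1 (term u 1 ^ n) * AddMonoidAlgebra.single (-(n • u)) 1 = 1
    rw [hpow, restrHom_term_of_mem (nsmul_mem hu n), AddMonoidAlgebra.single_mul_single,
      add_neg_cancel, mul_one]
    rfl
  · rintro ⟨_, y, rfl⟩
    have key : ∃ (n : ℕ) (f : 𝓜.ToricFaceRing k),
        AddMonoidAlgebra.mapDomainRingHom k (𝓜.Λ F.1).subtype y * restrHom F.1 (term u 1 ^ n) =
          restrHom F.1 f := by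
      induction y using AddMonoidAlgebra.induction_linear with
      | zero => exact ⟨0, 0, by simp⟩
      | add x y hx hy =>
        obtain ⟨n, f, hf⟩ := hx
        obtain ⟨n', f', hf'⟩ := hy
        refine ⟨n + n', f * term u 1 ^ n' + f' * term u 1 ^ n, ?_⟩
        rw [map_add, map_add, map_mul, map_mul, ← hf, ← hf', pow_add, map_mul]
        ring
      | single m a =>
        obtain ⟨x, hx, y, hy, hxy⟩ := mem_Λ.1 m.2
        obtain ⟨n, y', hy', h⟩ := exists_add_eq_nsmul_genSum hy
        refine ⟨n, term (x + y') a, ?_⟩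
        rw [hpow, restrHom_term_of_mem (nsmul_mem hu n), restrHom_term_of_mem (add_mem hx hy'),
          AddMonoidAlgebra.mapDomainRingHom_apply, AddMonoidAlgebra.mapDomain_single,
          AddMonoidAlgebra.single_mul_single, mul_one, ← h]
        congr 1
        change (m : M) + _ = _
        rw [hxy]
        abel
    obtain ⟨n, f, hf⟩ := key
    exact ⟨(f, ⟨_, n, rfl⟩), Subtype.ext hf⟩
  · intro f g hfg
    -- One factor of the monomial suffices: it restricts to zero on every facet other than `F`.
    refine ⟨⟨_, 1, rfl⟩, ext_facet fun G => ?_⟩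
    have h1 : restrHom F.1 f = restrHom F.1 g := congrArg Subtype.val hfg
    simp only [pow_one, map_mul]
    by_cases h : F = G
    · rw [← h, h1]
    · rw [restrHom_term_of_notMem (fun h' => h (Facet.eq_of_le (genSum_mem_iff.1 h'))), zero_mul,
        zero_mul]

variable [Module.Free ℤ M] [Module.Finite ℤ M]

theorem uniqueFactorizationMonoid_groupSubring (σ : 𝓜.fan.Cone) :
    UniqueFactorizationMonoid (groupSubring 𝓜 k σ) := by
  have h1 : Module.Free ℤ (𝓜.Λ σ) :=
    inferInstanceAs (Module.Free ℤ (AddSubgroup.toIntSubmodule (𝓜.Λ σ)))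
  have h2 : Module.Finite ℤ (𝓜.Λ σ) :=
    inferInstanceAs (Module.Finite ℤ (AddSubgroup.toIntSubmodule (𝓜.Λ σ)))
  have hinj : Function.Injective (AddMonoidAlgebra.mapDomainRingHom k (𝓜.Λ σ).subtype) :=
    AddMonoidAlgebra.mapDomain_injective Subtype.val_injective
  exact (RingEquiv.ofBijective
    (AddMonoidAlgebra.mapDomainRingHom k (𝓜.Λ σ).subtype).rangeRestrict
    ⟨fun x y h => hinj (congrArg Subtype.val h), RingHom.rangeRestrict_surjective _⟩).toMulEquiv
      |>.uniqueFactorizationMonoid (uniqueFactorizationMonoid_addMonoidAlgebra k _)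

/-- Inverting the monomial of `genSum F` gives `k[Λ_F]`, so `k[𝓜]_p` is a localization of a
factorial ring and `two_le_localRingDepth_of_uniqueFactorizationMonoid` applies. -/
theorem two_le_depth_of_facet (F : 𝓜.Facet) (p : Ideal (𝓜.ToricFaceRing k)) [p.IsPrime]
    (hF : coneIdeal k F.1 ≤ p) (hu : (term (𝓜.genSum F.1) 1 : 𝓜.ToricFaceRing k) ∉ p)
    (hht : 2 ≤ p.height) : 2 ≤ localRingDepth (Localization.AtPrime p) := by
  have hdom := isDomain_addMonoidAlgebra k M
  have hufd := uniqueFactorizationMonoid_groupSubring (k := k) F.1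
  let _ := (restrGroup k F.1).toAlgebra
  have hloc := isLocalization_restrGroup (k := k) F
  have hle : Submonoid.powers (term (𝓜.genSum F.1) 1 : 𝓜.ToricFaceRing k) ≤ p.primeCompl :=
    Submonoid.powers_le.2 hu
  let φ : groupSubring 𝓜 k F.1 →+* Localization.AtPrime p :=
    IsLocalization.lift (M := Submonoid.powers (term (𝓜.genSum F.1) 1 : 𝓜.ToricFaceRing k))
      (g := algebraMap _ _) fun y => IsLocalization.map_units _ (⟨y, hle y.2⟩ : p.primeCompl)
  let _ := φ.toAlgebra
  have : IsScalarTower (𝓜.ToricFaceRing k) (groupSubring 𝓜 k F.1) (Localization.AtPrime p) :=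
    .of_algebraMap_eq fun x => (IsLocalization.lift_eq _ x).symm
  have hloc' := IsLocalization.isLocalization_of_submonoid_le (groupSubring 𝓜 k F.1)
    (Localization.AtPrime p) _ p.primeCompl hle
  have hdomp : IsDomain (Localization.AtPrime p) := by
    refine IsLocalization.isDomain_of_le_nonZeroDivisors (R := groupSubring 𝓜 k F.1)
      (M := Submonoid.map (algebraMap (𝓜.ToricFaceRing k) (groupSubring 𝓜 k F.1)) p.primeCompl) _ ?_
    refine le_nonZeroDivisors_of_noZeroDivisors ?_
    rintro ⟨s, hs, h0⟩
    exact hs (hF (mem_coneIdeal.2 (congrArg Subtype.val h0)))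
  have := UniqueFactorizationMonoid.of_isLocalization
    (Submonoid.map (algebraMap (𝓜.ToricFaceRing k) (groupSubring 𝓜 k F.1)) p.primeCompl)
    (Localization.AtPrime p)
  refine two_le_localRingDepth_of_uniqueFactorizationMonoid ?_
  rw [IsLocalization.AtPrime.ringKrullDim_eq_height p]
  exact WithBot.coe_le_coe.2 hht

end FacetLocalization

/-! ### Reduction of `S₂` to a condition on single degrees. -/

section Depth

theorem coeff_restrHom_eq_of_le {σ τ : 𝓜.fan.Cone} (h : σ ≤ τ) (f : 𝓜.ToricFaceRing k) {m : M}
    (hm : m ∈ 𝓜.S σ) : (restrHom σ f).coeff m = (restrHom τ f).coeff m := by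
  rw [coeff_restrHom σ f hm, coeff_restrHom τ f (S_mono h hm)]

/-- Here `f₀` is the part of `f` supported on `S_σ`; it looks the same on every cone containing `σ`.
-/
theorem exists_sub_mem_coneIdeal (σ : 𝓜.fan.Cone) (f : 𝓜.ToricFaceRing k) :
    ∃ f₀ : 𝓜.ToricFaceRing k, f - f₀ ∈ coneIdeal k σ ∧
      ∀ τ, σ ≤ τ → restrHom τ f₀ = restrHom σ f := by
  classical
  refine ⟨⟨f.coeff.filter fun m => (m : M) ∈ 𝓜.S σ⟩, ?_, ?_⟩
  swap
  · intro τ hτ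
    refine AddMonoidAlgebra.coeff_injective (Finsupp.ext fun m => ?_)
    by_cases hm : m ∈ 𝓜.S σ
    · rw [coeff_restrHom _ _ hm, coeff_restrHom _ _ (S_mono hτ hm)]
      exact Finsupp.filter_apply_pos _ _ hm
    · rw [coeff_restrHom_of_notMem _ _ hm]
      by_cases hm' : m ∈ 𝓜.S τ
      · rw [coeff_restrHom _ _ hm']
        exact Finsupp.filter_apply_neg _ _ hm
      · rw [coeff_restrHom_of_notMem _ _ hm']
  · rw [mem_coneIdeal, map_sub, sub_eq_zero]
    refine AddMonoidAlgebra.coeff_injective (Finsupp.ext fun m => ?_)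
    by_cases hm : m ∈ 𝓜.S σ
    · rw [coeff_restrHom _ _ hm, coeff_restrHom _ _ hm]
      exact (Finsupp.filter_apply_pos (fun m : 𝓜.support => (m : M) ∈ 𝓜.S σ) f.coeff hm).symm
    · rw [coeff_restrHom_of_notMem _ _ hm, coeff_restrHom_of_notMem _ _ hm]

theorem toPi_term_mul_single_mem_range {σ : 𝓜.fan.Cone} {v m : M} (hv : v ∈ 𝓜.S σ)
    {c : 𝓜.Facet → k} (hc : ∀ F, c F ≠ 0 → σ ≤ F.1) (h : 𝓜.Compatible (v + m) c) :
    toPi 𝓜 k (term v 1) * (fun F => AddMonoidAlgebra.single m (c F)) ∈ (toPi 𝓜 k).range := by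
  classical
  rw [toPi_term_mul_mem_range]
  intro m'
  by_cases hm : m' = m
  · subst hm
    convert h using 2 with F
    split_ifs with h'
    · simp
    · by_contra hne
      exact h' (S_mono (hc F (Ne.symm hne)) hv)
  · convert Compatible.zero (k := k) (𝓜 := 𝓜) (v + m') using 2 with F
    simp [Ne.symm hm]

variable [Module.Free ℤ M]

/-- If `f ∉ P_σ`, multiplication by `f` can be undone up to a monomial of `S_σ`. -/
theorem exists_term_mul_mem_range_of_mul {σ : 𝓜.fan.Cone} {f₀ : 𝓜.ToricFaceRing k}
    (hf₀ : ∀ τ, σ ≤ τ → restrHom τ f₀ = restrHom σ f₀) (hne : restrHom σ f₀ ≠ 0) (T : Finset M)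
    (b : 𝓜.Facet → AddMonoidAlgebra k M) (hb : ∀ F, b F ≠ 0 → σ ≤ F.1)
    (hT : ∀ F, (b F).coeff.support ⊆ T) (n : ℕ)
    (h : toPi 𝓜 k (term (n • 𝓜.genSum σ) 1) * (toPi 𝓜 k f₀ * b) ∈ (toPi 𝓜 k).range) :
    ∃ n : ℕ, toPi 𝓜 k (term (n • 𝓜.genSum σ) 1) * b ∈ (toPi 𝓜 k).range := by
  classical
  have := twoUniqueSums_of_free M
  induction T using Finset.strongInduction generalizing b n with
  | H T ih =>
    rcases T.eq_empty_or_nonempty with rfl | hTne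
    · refine ⟨0, ?_⟩
      have : b = 0 := by
        funext F
        have := hT F
        rw [Finset.subset_empty, Finsupp.support_eq_empty, AddMonoidAlgebra.coeff_eq_zero] at this
        exact this
      rw [this, mul_zero]
      exact zero_mem _
    set u := 𝓜.genSum σ
    have hu : u ∈ 𝓜.S σ := genSum_mem σ
    set φ := restrHom σ f₀
    have hφ : φ.coeff.support.Nonempty := by
      rw [Finsupp.support_nonempty_iff, ne_eq, AddMonoidAlgebra.coeff_eq_zero]
      exact hne
    -- As `s + m` arises only once, the coefficient of `f₀ b` there is `φ_s c_F` on every facet with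
    -- the same nonzero `φ_s`. Hence the degree `m` part of `b` is compatible after a shift by a
    -- monomial; it is subtracted and the induction continues.
    obtain ⟨s, hs, m, hm, huniq⟩ := UniqueSums.uniqueAdd_of_nonempty hφ hTne
    have hsφ : φ.coeff s ≠ 0 := Finsupp.mem_support_iff.1 hs
    have hsσ : s ∈ 𝓜.S σ := by
      by_contra hcon
      exact hsφ (coeff_restrHom_of_notMem σ f₀ hcon)
    let c : 𝓜.Facet → k := fun F => (b F).coeff m
    have hc : ∀ F, c F ≠ 0 → σ ≤ F.1 := fun F hF => hb F fun h0 => hF (by simp [c, h0])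
    have hcoeff : ∀ F, ((toPi 𝓜 k f₀ * b) F).coeff (s + m) = φ.coeff s * c F := by
      intro F
      rw [Pi.mul_apply, toPi_apply]
      by_cases h0 : b F = 0
      · simp [c, h0]
      · rw [hf₀ F.1 (hb F h0)]
        exact AddMonoidAlgebra.coeff_mul_add_of_uniqueAdd
          (huniq.mono (Finset.Subset.refl _) (hT F))
    obtain ⟨h1, h2⟩ := (toPi_term_mul_mem_range.1 h) (s + m)
    have hcompat : 𝓜.Compatible (n • u + (s + m)) c := by
      have hval : ∀ F : 𝓜.Facet, (if n • u ∈ 𝓜.S F.1 then ((toPi 𝓜 k f₀ * b) F).coeff (s + m)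
          else 0) = φ.coeff s * c F := by
        intro F
        rw [hcoeff]
        split_ifs with h'
        · rfl
        · by_contra hcon
          have : c F ≠ 0 := fun h0 => hcon (by rw [h0, mul_zero])
          exact h' (S_mono (hc F this) (nsmul_mem hu n))
      simp only [hval] at h1 h2
      exact ⟨fun F hF => h1 F (mul_ne_zero hsφ hF), fun F F' h h' =>
        mul_left_cancel₀ hsφ (h2 F F' h h')⟩
    obtain ⟨n', s', hs', hss'⟩ := exists_add_eq_nsmul_genSum hsσ
    have hcompat' : 𝓜.Compatible ((n + n') • u + m) c := by
      have := hcompat.add_left hs' hc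
      convert this using 1
      rw [add_smul, ← hss']
      abel
    let e : 𝓜.Facet → AddMonoidAlgebra k M := fun F => AddMonoidAlgebra.single m (c F)
    have he : toPi 𝓜 k (term ((n + n') • u) 1) * e ∈ (toPi 𝓜 k).range :=
      toPi_term_mul_single_mem_range (nsmul_mem hu _) hc hcompat'
    have hshift : ∀ (l l' : ℕ) (x : 𝓜.Facet → AddMonoidAlgebra k M),
        toPi 𝓜 k (term (l • u) 1) * x ∈ (toPi 𝓜 k).range →
        toPi 𝓜 k (term ((l' + l) • u) 1) * x ∈ (toPi 𝓜 k).range := by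
      intro l l' x hx
      rw [← term_nsmul_mul_term_nsmul, map_mul, mul_assoc]
      exact mul_mem ⟨_, rfl⟩ hx
    obtain ⟨N, hN⟩ := ih (T.erase m) (Finset.erase_ssubset hm) (b - e)
      (fun F hF => hb F fun h0 => by
        apply hF
        simp [e, c, h0]) (fun F x hx => by
        have hx' := Finsupp.mem_support_iff.1 hx
        simp only [Pi.sub_apply, AddMonoidAlgebra.coeff_sub, Finsupp.sub_apply, e, c,
          AddMonoidAlgebra.coeff_single] at hx'
        have hxm : x ≠ m := by
          rintro rfl
          simp at hx'
        rw [Finsupp.single_eq_of_ne hxm, sub_zero] at hx'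
        exact Finset.mem_erase.2 ⟨hxm, hT F (Finsupp.mem_support_iff.2 hx')⟩) (n + n') (by
        have e1 : toPi 𝓜 k (term ((n + n') • u) 1) * (toPi 𝓜 k f₀ * (b - e)) =
            toPi 𝓜 k (term ((n' + n) • u) 1) * (toPi 𝓜 k f₀ * b) -
              toPi 𝓜 k f₀ * (toPi 𝓜 k (term ((n + n') • u) 1) * e) := by
          rw [add_comm n' n]
          ring
        rw [e1]
        exact sub_mem (hshift _ _ _ h) (mul_mem ⟨_, rfl⟩ he))
    refine ⟨N + (n + n'), ?_⟩
    have e2 : toPi 𝓜 k (term ((N + (n + n')) • u) 1) * b =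
        toPi 𝓜 k (term ((n + n' + N) • u) 1) * (b - e) +
          toPi 𝓜 k (term ((N + (n + n')) • u) 1) * e := by
      rw [add_comm (n + n') N]
      ring
    rw [e2]
    exact add_mem (hshift _ _ _ hN) (hshift _ _ _ he)

/-- If `b` is multiplied into `k[𝓜]` by `P_σ` and by some `f ∉ P_σ`, then also by a monomial of
`S_σ`. -/
theorem exists_term_mul_mem_range {σ : 𝓜.fan.Cone} {b : 𝓜.Facet → AddMonoidAlgebra k M}
    (hb : ∀ w ∈ coneIdeal k σ, toPi 𝓜 k w * b ∈ (toPi 𝓜 k).range) {f : 𝓜.ToricFaceRing k}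
    (hf : f ∉ coneIdeal k σ) (hfb : toPi 𝓜 k f * b ∈ (toPi 𝓜 k).range) :
    ∃ n : ℕ, toPi 𝓜 k (term (n • 𝓜.genSum σ) 1) * b ∈ (toPi 𝓜 k).range := by
  classical
  let _ : Fintype 𝓜.Facet := Fintype.ofFinite _
  obtain ⟨f₀, h1, h2⟩ := exists_sub_mem_coneIdeal σ f
  have h3 : restrHom σ f₀ = restrHom σ f := h2 σ le_rfl
  set u := 𝓜.genSum σ
  have hf₀b : toPi 𝓜 k f₀ * b ∈ (toPi 𝓜 k).range := by
    have := sub_mem hfb (hb _ h1)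
    rw [← sub_mul, ← map_sub, sub_sub_cancel] at this
    exact this
  -- Multiplying by `χ^u` first leaves only the components on facets containing `σ`, as the
  -- preceding lemma requires.
  let b' := toPi 𝓜 k (term u 1) * b
  obtain ⟨n, hn⟩ := exists_term_mul_mem_range_of_mul (σ := σ) (f₀ := f₀)
    (fun τ hτ => (h2 τ hτ).trans h3.symm) (by rw [h3]; exact hf)
    (Finset.univ.biUnion fun F => (b' F).coeff.support) b' (fun F hF => by
      by_contra hcon
      apply hF
      change restrHom F.1 (term u 1) * b F = 0
      rw [restrHom_term_of_notMem (fun h => hcon (genSum_mem_iff.1 h)), zero_mul])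
    (fun F => Finset.subset_biUnion_of_mem (fun F => (b' F).coeff.support) (Finset.mem_univ F))
    0 (by
      rw [zero_smul, ← one_eq_term, map_one, one_mul]
      have : toPi 𝓜 k f₀ * b' = toPi 𝓜 k (term u 1) * (toPi 𝓜 k f₀ * b) := by
        simp only [b']; ring
      rw [this]
      exact mul_mem ⟨_, rfl⟩ hf₀b)
  refine ⟨n + 1, ?_⟩
  rw [← term_nsmul_mul_term_nsmul, one_smul, map_mul, mul_assoc]
  exact hn

variable [Module.Finite ℤ M]

open Classical in
/-- Serre's condition `S₂` for `k[𝓜]` follows from a combinatorial condition on the cones `σ` which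
lie properly below a cone that is not a facet. -/
theorem satisfiesSerre_two_of_compatible
    (H : ∀ σ ρ : 𝓜.fan.Cone, σ < ρ → ¬ IsFacet ρ → ∀ (m : M) (c : 𝓜.Facet → k),
      (∀ v ∈ 𝓜.support, v ∉ 𝓜.S σ →
        𝓜.Compatible (v + m) fun F => if v ∈ 𝓜.S F.1 then c F else 0) →
      ∃ n : ℕ, 𝓜.Compatible (n • 𝓜.genSum σ + m) fun F => if σ ≤ F.1 then c F else 0) :
    SatisfiesSerre 2 (𝓜.ToricFaceRing k) := by
  let _ : Fintype 𝓜.Facet := Fintype.ofFinite _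
  refine satisfiesSerre_two_of (fun p _ h => one_le_depth_atPrime p h) fun p hp hht => ?_
  obtain ⟨σ, hσp, hσ⟩ := exists_cone_of_isPrime p
  by_cases hfacet : IsFacet σ
  · exact two_le_depth_of_facet ⟨σ, hfacet⟩ p hσp (hσ _ (genSum_mem σ)) hht
  refine two_le_depth_of_exists_mul_mem_range p (hσp (facetSum_mem hfacet)) fun b hb => ?_
  have hbσ : ∀ w ∈ coneIdeal k σ, toPi 𝓜 k w * b ∈ (toPi 𝓜 k).range := fun w hw => hb w (hσp hw)
  suffices ∃ n : ℕ, toPi 𝓜 k (term (n • 𝓜.genSum σ) 1) * b ∈ (toPi 𝓜 k).range by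
    obtain ⟨n, hn⟩ := this
    exact ⟨_, hσ _ (nsmul_mem (genSum_mem σ) n), hn⟩
  by_cases hcov : ∃ ρ, σ < ρ ∧ ¬ IsFacet ρ
  · obtain ⟨ρ, hρ, hρf⟩ := hcov
    have key : ∀ m, ∃ n : ℕ, 𝓜.Compatible (n • 𝓜.genSum σ + m) fun F =>
        if σ ≤ F.1 then (b F).coeff m else 0 := fun m =>
      H σ ρ hρ hρf m _ fun v hv hvσ => toPi_term_mul_mem_range.1
        (hbσ _ ((term_mem_coneIdeal one_ne_zero).2 hvσ)) m
    choose n hn using key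
    let T : Finset M := Finset.univ.biUnion fun F => (b F).coeff.support
    -- One exponent for all degrees; the extra `1` ensures that `N • genSum σ ∈ S_F` forces `σ ≤ F`.
    let N := ∑ m ∈ T, n m + 1
    refine ⟨N, toPi_term_mul_mem_range.2 fun m => ?_⟩
    by_cases hm : m ∈ T
    · obtain ⟨l, hl⟩ := Nat.exists_eq_add_of_le (show n m ≤ N from
        (Finset.single_le_sum (fun _ _ => Nat.zero_le _) hm).trans (Nat.le_succ _))
      have h1 := (hn m).add_left (nsmul_mem (genSum_mem σ) l) fun F hF => by
        by_contra hcon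
        exact hF (if_neg hcon)
      convert h1 using 1
      · rw [hl, add_smul]; abel
      · funext F
        congr 1
        rw [eq_iff_iff]
        constructor
        · intro h
          refine genSum_mem_iff.1 ?_
          have : N • 𝓜.genSum σ = 𝓜.genSum σ + (∑ m ∈ T, n m) • 𝓜.genSum σ := succ_nsmul' _ _
          rw [this] at h
          exact mem_of_add_mem (genSum_mem σ) (nsmul_mem (genSum_mem σ) _) h
        · exact fun h => S_mono h (nsmul_mem (genSum_mem σ) _)
    · convert Compatible.zero (k := k) (𝓜 := 𝓜) (N • 𝓜.genSum σ + m) using 2 with F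
      have : (b F).coeff m = 0 := by
        by_contra hne
        exact hm (Finset.mem_biUnion.2 ⟨F, Finset.mem_univ _, Finsupp.mem_support_iff.2 hne⟩)
      simp [this]
  · push Not at hcov
    have hne : p ≠ coneIdeal k σ := by
      rintro rfl
      -- Every cone `ρ` strictly above `σ` is a facet. A prime with such a cone and containing
      -- `facetSum` would contain the monomial of `genSum ρ`, since `facetSum` reduces to it modulo
      -- `P_ρ`. So Krull's theorem bounds the height of `P_σ` by one.
      have hmin : coneIdeal k σ ∈ (Ideal.span {facetSum 𝓜 k}).minimalPrimes := by
        refine ⟨⟨inferInstance, (Ideal.span_singleton_le_iff_mem _).2 (facetSum_mem hfacet)⟩, ?_⟩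
        intro q ⟨hq, hxq⟩ hle
        obtain ⟨ρ, hρq, hρ⟩ := exists_cone_of_isPrime q
        rcases eq_or_lt_of_le (le_of_coneIdeal_le (hρq.trans hle)) with rfl | hlt
        · exact hρq
        · exfalso
          refine hρ _ (genSum_mem ρ) ?_
          have h1 : facetSum 𝓜 k - term (𝓜.genSum ρ) 1 ∈ coneIdeal k ρ := by
            rw [mem_coneIdeal, map_sub, restrHom_facetSum ⟨ρ, hcov ρ hlt⟩,
              restrHom_term_of_mem (genSum_mem ρ), sub_self]
          have h2 := sub_mem ((Ideal.span_singleton_le_iff_mem _).1 hxq) (hρq h1)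
          rwa [sub_sub_cancel] at h2
      have := hht.trans (Ideal.height_le_one_of_isPrincipal_of_mem_minimalPrimes _ _ hmin)
      exact absurd this (by decide)
    obtain ⟨f, hfp, hf⟩ := SetLike.exists_of_lt (lt_of_le_of_ne hσp (Ne.symm hne))
    exact exists_term_mul_mem_range hbσ hf (hb f hfp)

end Depth

end ToricFaceRing

end MonoidalComplex

/-! ### From `S₂` to connectedness and the lattice condition. -/

namespace MonoidalComplex

open RationalFan

variable {M : Type*} [AddCommGroup M] {𝓜 : MonoidalComplex M}

theorem Compatible.of_imp {k : Type*} [Zero k] {m : M} {c : 𝓜.Facet → k}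
    (h : ∀ F, c F ≠ 0 → m ∈ 𝓜.S F.1)
    (h' : ∀ F F' : 𝓜.Facet, m ∈ 𝓜.S F.1 → m ∈ 𝓜.S F'.1 → c F ≠ 0 → c F' = c F) :
    𝓜.Compatible m c := by
  refine ⟨h, fun F F' hF hF' => ?_⟩
  by_cases h0 : c F = 0
  · by_cases h1 : c F' = 0
    · rw [h0, h1]
    · exact h' F' F hF' hF h1
  · exact (h' F F' hF hF' h0).symm

theorem not_isFacet_of_lt {σ τ : 𝓜.fan.Cone} (h : σ < τ) : ¬ IsFacet σ := not_isMax_iff.2 ⟨τ, h⟩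

/-- In a seminormal complex, a lattice point `x` of the cone `F` lies in the semigroup of the face
containing it in its relative interior as soon as it lies in the lattice of that face. -/
theorem exists_face_mem_S [Module.Free ℤ M] [Module.Finite ℤ M]
    (hsn : ∀ (σ : 𝓜.fan.Cone) (m : M), 2 • m ∈ 𝓜.S σ → 3 • m ∈ 𝓜.S σ → m ∈ 𝓜.S σ)
    {F : 𝓜.fan.Cone} {x : M} (hx : latticeMap M x ∈ F.1) :
    ∃ ρ ≤ F, latticeMap M x ∈ ρ.1 ∧ (∀ y ∈ F.1, latticeMap M x - y ∈ F.1 → y ∈ ρ.1) ∧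
      (x ∈ 𝓜.Λ ρ → x ∈ 𝓜.S ρ) := by
  refine ⟨⟨PointedCone.minFace F.1 (latticeMap M x), 𝓜.fan.face_mem _ F.2 _
    (PointedCone.minFace_isFaceOf _ _)⟩, fun y hy => (PointedCone.mem_minFace.1 hy).1,
    PointedCone.self_mem_minFace hx, fun y hy hxy => PointedCone.mem_minFace.2
    ⟨hy, 1, zero_le_one, by rwa [one_smul]⟩, fun hΛ => ?_⟩
  obtain ⟨c, -, hc⟩ := PointedCone.exists_smul_sub_mem_minFace
    (latticeMap_mem (genSum_mem (𝓜 := 𝓜) ⟨PointedCone.minFace F.1 (latticeMap M x),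
      𝓜.fan.face_mem _ F.2 _ (PointedCone.minFace_isFaceOf _ _)⟩))
  exact mem_S_of_seminormal hsn hΛ (PointedCone.self_mem_minFace hx) hc

namespace ToricFaceRing

variable {k : Type*} [Field k]

theorem exists_coeff_ne_zero {σ : 𝓜.fan.Cone} {f : 𝓜.ToricFaceRing k} (hf : f ∉ coneIdeal k σ) :
    ∃ w ∈ 𝓜.S σ, (restrHom σ f).coeff w ≠ 0 := by
  by_contra! hcon
  refine hf (AddMonoidAlgebra.coeff_injective (Finsupp.ext fun w => ?_))
  by_cases hw : w ∈ 𝓜.S σ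
  · exact hcon w hw
  · exact coeff_restrHom_of_notMem σ f hw

variable [Module.Free ℤ M]

open Classical in
-- The multiplier `s ∉ P_σ` supplied by depth two has a nonzero coefficient `s_w` with `w ∈ S_σ`,
-- and the degree `w + m` part of `s (c_F χ^m)_F` has coefficients `s_w c_F`.
theorem exists_compatible_of_two_le_depth {σ : 𝓜.fan.Cone} (hσ : ¬ IsFacet σ)
    (h : 2 ≤ localRingDepth (Localization.AtPrime (coneIdeal k σ))) {m : M} {c : 𝓜.Facet → k}
    (hc : ∀ F, c F ≠ 0 → σ ≤ F.1)
    (H : ∀ v ∈ 𝓜.support, v ∉ 𝓜.S σ →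
      𝓜.Compatible (v + m) fun F => if v ∈ 𝓜.S F.1 then c F else 0) :
    ∃ w ∈ 𝓜.S σ, 𝓜.Compatible (w + m) c := by
  obtain ⟨s, hs, hsb⟩ := exists_mul_mem_range_of_two_le_depth (coneIdeal k σ) (facetSum_mem hσ) h
    (b := fun F => AddMonoidAlgebra.single m (c F)) (coneIdeal_mul_mem_range fun v hv hvσ =>
      toPi_term_mul_mem_range.2 fun m' => by
        by_cases hm : m' = m
        · subst hm
          simpa using H v hv hvσ
        · convert Compatible.zero (k := k) (𝓜 := 𝓜) (v + m') using 2 with F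
          simp [Ne.symm hm])
  obtain ⟨w, hw, hsw⟩ := exists_coeff_ne_zero hs
  refine ⟨w, hw, ?_⟩
  have hval : ∀ F, ((toPi 𝓜 k s * fun F => AddMonoidAlgebra.single m (c F)) F).coeff (w + m) =
      (restrHom σ s).coeff w * c F := by
    intro F
    rw [Pi.mul_apply, toPi_apply]
    by_cases h0 : c F = 0
    · simp [h0]
    · rw [AddMonoidAlgebra.coeff_mul_single_apply, coeff_restrHom_eq_of_le (hc F h0) s hw]
      simp
  obtain ⟨h1, h2⟩ := mem_range_toPi.1 hsb (w + m)
  simp only [hval] at h1 h2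
  exact ⟨fun F hF => h1 F (mul_ne_zero hsw hF),
    fun F F' hF hF' => mul_left_cancel₀ hsw (h2 F F' hF hF')⟩

variable [Module.Finite ℤ M]

theorem two_le_height_coneIdeal {σ F : 𝓜.fan.Cone} (h : σ ≤ F)
    (hdim : coneDim σ.1 + 2 ≤ coneDim F.1) : 2 ≤ (coneIdeal k σ).height := by
  obtain ⟨ρ, h1, h2⟩ := exists_between (lt_of_le_of_ne h (by rintro rfl; omega)) hdim
  exact two_le_height (coneIdeal_lt h2) (coneIdeal_lt h1)

theorem isOneConnected_of_satisfiesSerre (h : SatisfiesSerre 2 (𝓜.ToricFaceRing k)) :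
    𝓜.fan.IsOneConnected := by
  classical
  intro F F' hF hF' hne
  let r : 𝓜.fan.Cone → 𝓜.fan.Cone → Prop := fun G G' => IsFacet G' ∧ F.1 ⊓ F'.1 ≤ G'.1 ∧
    coneDim (G.1 ⊓ G'.1) + 1 = coneDim G.1 ∧ coneDim (G.1 ⊓ G'.1) + 1 = coneDim G'.1
  suffices hr : Relation.ReflTransGen r F F' by
    obtain ⟨n, f, h0, hn, hf⟩ := hr.exists_seq
    refine ⟨n, f, h0, hn, fun i hi => ?_, fun i hi => (hf i hi).2.2⟩
    cases i with
    | zero => exact h0.symm ▸ ⟨hF, inf_le_left⟩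
    | succ i => exact ⟨(hf i hi).1, (hf i hi).2.1⟩
  let P : 𝓜.Facet → Prop := fun G => Relation.ReflTransGen r F G.1
  by_contra hcon
  -- Among the pairs of a reachable and an unreachable facet containing `F ∩ F'`, one with
  -- intersection of maximal dimension.
  obtain ⟨⟨G, G'⟩, ⟨hG, hG', hDG, hDG'⟩, hmax⟩ := Set.exists_max_image
    {q : 𝓜.Facet × 𝓜.Facet | P q.1 ∧ ¬ P q.2 ∧ meet F F' ≤ q.1.1 ∧ meet F F' ≤ q.2.1}
    (fun q => coneDim (meet q.1.1 q.2.1).1) (Set.toFinite _)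
    ⟨(⟨F, hF⟩, ⟨F', hF'⟩), Relation.ReflTransGen.refl, hcon, meet_le_left _ _, meet_le_right _ _⟩
  set τ := meet G.1 G'.1
  have hGG' : G ≠ G' := by
    rintro rfl
    exact hG' hG
  have hτG : τ < G.1 := lt_of_le_of_ne (meet_le_left _ _) fun e =>
    hGG' (Facet.eq_of_le (e ▸ meet_le_right G.1 G'.1))
  have hτG' : τ < G'.1 := lt_of_le_of_ne (meet_le_right _ _) fun e =>
    hGG' (Facet.eq_of_le (e ▸ meet_le_left G.1 G'.1)).symm
  -- If `τ` had codimension one in both facets, `G'` would be reachable from `G` in one step.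
  have hht : 2 ≤ (coneIdeal k τ).height := by
    have h1 := coneDim_lt hτG
    have h2 := coneDim_lt hτG'
    by_cases h3 : coneDim τ.1 + 2 ≤ coneDim G.1.1
    · exact two_le_height_coneIdeal hτG.le h3
    by_cases h4 : coneDim τ.1 + 2 ≤ coneDim G'.1.1
    · exact two_le_height_coneIdeal hτG'.le h4
    exact (hG' (hG.tail ⟨G'.2, hDG', by change coneDim τ.1 + 1 = coneDim G.1.1; omega,
      by change coneDim τ.1 + 1 = coneDim G'.1.1; omega⟩)).elim
  -- The test family is the indicator of the reachable facets containing `τ`, in the degree of an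
  -- interior point of `τ`, so that any facet meeting the shifted degree contains `τ`.
  obtain ⟨w, hw, hcompat⟩ := exists_compatible_of_two_le_depth (not_isFacet_of_lt hτG)
    (h.two_le_localRingDepth _ hht) (m := 𝓜.genSum τ)
    (c := fun H => if P H ∧ τ ≤ H.1 then 1 else 0) (fun H hH => by
      by_contra hcon
      exact hH (if_neg fun h => hcon h.2)) fun v hv hvτ => by
      refine Compatible.of_imp (fun H hH => ?_) fun H H' hvH hvH' hH => ?_
      · simp only [ne_eq, ite_eq_right_iff, not_forall] at hH
        obtain ⟨h1, h2, -⟩ := hH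
        exact add_mem h1 (genSum_mem_iff.2 h2.2)
      · simp only [ne_eq, ite_eq_right_iff, not_forall] at hH
        obtain ⟨h1, h2, -⟩ := hH
        obtain ⟨h3, h4⟩ := mem_and_le_of_add_genSum_mem h1 h2.2 (latticeMap_mem hvH')
        have hDτ : meet F F' ≤ τ := le_meet hDG hDG'
        have h5 : P H' := by
          by_contra h5
          have h6 := hmax (H, H') ⟨h2.1, h5, hDτ.trans h2.2, hDτ.trans h4⟩
          -- A reachable and an unreachable facet sharing both `τ` and `v ∉ S_τ` would meet in a
          -- larger cone, against maximality.
          have h7 : τ < meet H.1 H'.1 := lt_of_le_of_ne (le_meet h2.2 h4) fun e => hvτ <| by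
            rw [e]
            exact mem_of_latticeMap_mem h1 ⟨latticeMap_mem h1, latticeMap_mem h3⟩
          exact absurd (coneDim_lt h7) (not_lt.2 h6)
        simp [h1, h2, h3, h4, h5]
  have hmem := add_mem hw (genSum_mem τ)
  have := hcompat.2 G G' (S_mono hτG.le hmem) (S_mono hτG'.le hmem)
  simp [hG, hG', hτG.le] at this

theorem mem_Λ_of_forall_lt (h : SatisfiesSerre 2 (𝓜.ToricFaceRing k))
    (hsn : ∀ (σ : 𝓜.fan.Cone) (m : M), 2 • m ∈ 𝓜.S σ → 3 • m ∈ 𝓜.S σ → m ∈ 𝓜.S σ)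
    {σ : 𝓜.fan.Cone} {F : 𝓜.Facet} (hF : σ ≤ F.1) (hdim : coneDim σ.1 + 2 ≤ coneDim F.1.1) {m : M}
    (hm : ∀ ρ, σ < ρ → m ∈ 𝓜.Λ ρ) : m ∈ 𝓜.Λ σ := by
  classical
  obtain ⟨n, hn⟩ := exists_add_nsmul_genSum_mem hF hdim fun ρ h _ => hm ρ h
  set u := 𝓜.genSum σ
  have hu := genSum_mem σ
  have huσ := latticeMap_mem hu
  -- The extra `u` makes the minimal face `ρ` carrying `v + (m + n • u + u)` contain `σ`. As `ρ`
  -- also contains `v ∉ S_σ`, it is strictly larger, so `m ∈ Λ_ρ` and seminormality places the point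
  -- in `S_ρ`.
  obtain ⟨w, hw, hcompat⟩ := exists_compatible_of_two_le_depth (k := k) (σ := σ)
    (m := m + n • u + u) (not_isFacet_of_lt (lt_of_le_of_ne hF (by rintro rfl; omega)))
    (h.two_le_localRingDepth _ (two_le_height_coneIdeal hF hdim))
    (c := fun H => if σ ≤ H.1 then 1 else 0) (fun H hH => by
      by_contra hcon
      exact hH (if_neg hcon)) fun v hv hvσ => by
      refine Compatible.of_imp (fun H hH => ?_) fun H H' hvH hvH' hH => ?_
      · simp only [ne_eq, ite_eq_right_iff, not_forall] at hH
        obtain ⟨h1, h2, -⟩ := hH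
        have hvH := latticeMap_mem h1
        have e : latticeMap M (v + (m + n • u + u)) = latticeMap M v +
          (latticeMap M (m + n • u) + latticeMap M u) := by rw [map_add, map_add]
        obtain ⟨ρ, hρ, h3, h4, h5⟩ := exists_face_mem_S hsn (F := H.1)
          (x := v + (m + n • u + u)) (by
            rw [e]
            exact add_mem hvH (add_mem (h2 hn) (h2 huσ)))
        have hvρ : v ∈ 𝓜.S ρ := mem_of_latticeMap_mem h1 <| h4 _ hvH <| by
          rw [e, add_sub_cancel_left]
          exact add_mem (h2 hn) (h2 huσ)
        have hσρ : σ ≤ ρ := le_of_latticeMap_genSum_mem <| h4 _ (h2 huσ) <| by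
          rw [e, ← add_assoc, add_sub_cancel_right]
          exact add_mem hvH (h2 hn)
        have huρ := S_le_Λ (S_mono hσρ hu)
        refine S_mono hρ (h5 (add_mem (S_le_Λ hvρ) (add_mem (add_mem (hm ρ (lt_of_le_of_ne hσρ ?_))
          (nsmul_mem huρ n)) huρ)))
        rintro rfl
        exact hvσ hvρ
      · simp only [ne_eq, ite_eq_right_iff, not_forall] at hH
        obtain ⟨h1, h2, -⟩ := hH
        have hvHc := latticeMap_mem h1
        have e : latticeMap M (v + (m + n • u + u)) = latticeMap M v +
          (latticeMap M (m + n • u) + latticeMap M u) := by rw [map_add, map_add]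
        have h3 : v ∈ 𝓜.S H'.1 := mem_of_latticeMap_mem h1 <| mem_of_sub_mem hvHc (by
          rw [e, add_sub_cancel_left]
          exact add_mem (h2 hn) (h2 huσ)) (latticeMap_mem hvH')
        have h4 : σ ≤ H'.1 := le_of_latticeMap_genSum_mem <| mem_of_sub_mem (h2 huσ) (by
          rw [e, ← add_assoc, add_sub_cancel_right]
          exact add_mem hvHc (h2 hn)) (latticeMap_mem hvH')
        simp [h1, h2, h3, h4]
  have hmem : w + (m + n • u + u) ∈ 𝓜.S σ := by
    refine mem_of_latticeMap_mem (hcompat.1 F (by simp [hF])) ?_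
    rw [map_add, map_add]
    exact add_mem (latticeMap_mem hw) (add_mem hn huσ)
  have e : m = w + (m + n • u + u) - w - u - n • u := by abel
  rw [e]
  exact sub_mem (sub_mem (sub_mem (S_le_Λ hmem) (S_le_Λ hw)) (S_le_Λ hu)) (nsmul_mem (S_le_Λ hu) n)

/-- Descending induction on `σ`: in codimension one the intersection includes `Λ_σ` itself, and in
higher codimension `mem_Λ_of_forall_lt` reduces to larger cones. -/
theorem Λ_eq_iInf_of_satisfiesSerre (h : SatisfiesSerre 2 (𝓜.ToricFaceRing k))
    (hsn : ∀ (σ : 𝓜.fan.Cone) (m : M), 2 • m ∈ 𝓜.S σ → 3 • m ∈ 𝓜.S σ → m ∈ 𝓜.S σ)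
    (σ : 𝓜.fan.Cone) (hσ : ¬ IsFacet σ) :
    𝓜.Λ σ = ⨅ (τ : 𝓜.fan.Cone) (_ : σ ≤ τ) (_ : codim τ = 1), 𝓜.Λ τ := by
  obtain ⟨d, hd⟩ := (isOneConnected_of_satisfiesSerre h).exists_coneDim_eq
  refine le_antisymm (le_iInf₂ fun τ hτ => le_iInf fun _ => Λ_mono hτ) fun m hm => ?_
  replace hm : ∀ τ, σ ≤ τ → codim τ = 1 → m ∈ 𝓜.Λ τ := by
    simpa only [AddSubgroup.mem_iInf] using hm
  induction σ using WellFoundedGT.induction with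
  | ind σ ih =>
    obtain ⟨F, hF⟩ := exists_facet_ge σ
    have hlt := coneDim_lt (lt_of_le_of_ne hF (by rintro rfl; exact hσ F.2))
    rw [hd _ F.2] at hlt
    by_cases hdim : coneDim σ.1 + 2 ≤ d
    · refine mem_Λ_of_forall_lt h hsn hF (by rwa [hd _ F.2]) fun ρ hρ => ?_
      -- The induction does not cover facets, so a facet `ρ` is replaced by a cone strictly between
      -- `σ` and `ρ`, whose lattice is contained in `Λ_ρ`.
      by_cases hfacet : IsFacet ρ
      · obtain ⟨ρ', h1, h2⟩ := exists_between hρ (by rwa [hd _ hfacet])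
        exact Λ_mono h2.le (ih ρ' h1 (not_isFacet_of_lt h2) fun τ hτ => hm τ (h1.le.trans hτ))
      · exact ih ρ hρ hfacet fun τ hτ => hm τ (hρ.le.trans hτ)
    · refine hm σ le_rfl ?_
      rw [codim_eq hd, show d - coneDim σ.1 = 1 by omega, Nat.cast_one]

end ToricFaceRing

end MonoidalComplex

/-! ### From connectedness to `S₂`. -/

namespace MonoidalComplex

open RationalFan

variable {M : Type*} [AddCommGroup M] {𝓜 : MonoidalComplex M}

open Classical in
/-- If the degree `m` part of a family is multiplied into `k[𝓜]` by the monomials outside `S_σ`,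
then its coefficients agree on the cones containing a cone `τ` which is not a face of `σ`, as soon
as `m` lies in `τ` up to a multiple of an element of `S_σ`. -/
theorem genSum_add_mem_of_compatible {k : Type*} [Zero k] {σ τ : 𝓜.fan.Cone} {m u : M}
    {c : 𝓜.Facet → k} (H : ∀ v ∈ 𝓜.support, v ∉ 𝓜.S σ →
      𝓜.Compatible (v + m) fun F => if v ∈ 𝓜.S F.1 then c F else 0)
    (hτσ : ¬ τ ≤ σ) (hu : u ∈ 𝓜.S τ) (hm : latticeMap M (u + m) ∈ τ.1) {F : 𝓜.Facet}
    (hF : τ ≤ F.1) (hc : c F ≠ 0) :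
    𝓜.genSum τ + (u + m) ∈ 𝓜.S τ ∧ ∀ F' : 𝓜.Facet, τ ≤ F'.1 → c F' = c F := by
  have hv := add_mem (genSum_mem τ) hu
  have hcomp := H (𝓜.genSum τ + u) ⟨τ, hv⟩ fun h =>
    hτσ (genSum_mem_iff.1 (mem_of_add_mem (genSum_mem τ) hu h))
  have hmem : 𝓜.genSum τ + (u + m) ∈ 𝓜.S τ := by
    refine mem_of_latticeMap_mem (τ := F.1) ?_ ?_
    · rw [← add_assoc]
      exact hcomp.1 F (by simpa only [if_pos (S_mono hF hv)] using hc)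
    · rw [map_add]
      exact add_mem (latticeMap_mem (genSum_mem τ)) hm
  refine ⟨hmem, fun F' hF' => ?_⟩
  rw [← add_assoc] at hmem
  have := hcomp.2 F' F (S_mono hF' hmem) (S_mono hF hmem)
  simpa only [if_pos (S_mono hF hv), if_pos (S_mono hF' hv)] using this

namespace ToricFaceRing

variable [Module.Finite ℤ M] {k : Type*} [Field k]

open Classical in
-- The hypothesis `h` is the membership half of compatibility; connectedness supplies the agreement
-- of the coefficients.
theorem satisfiesSerre_two_of_isOneConnected [Module.Free ℤ M] (hconn : 𝓜.fan.IsOneConnected)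
    (h : ∀ (σ : 𝓜.fan.Cone) (F : 𝓜.Facet), σ ≤ F.1 → coneDim σ.1 + 2 ≤ coneDim F.1.1 →
      ∀ (m : M) (c : 𝓜.Facet → k), (∀ v ∈ 𝓜.support, v ∉ 𝓜.S σ →
        𝓜.Compatible (v + m) fun F => if v ∈ 𝓜.S F.1 then c F else 0) →
      c F ≠ 0 → ∃ n : ℕ, n • 𝓜.genSum σ + m ∈ 𝓜.S F.1) :
    SatisfiesSerre 2 (𝓜.ToricFaceRing k) := by
  let _ : Fintype 𝓜.Facet := Fintype.ofFinite _
  obtain ⟨d, hd⟩ := hconn.exists_coneDim_eq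
  refine satisfiesSerre_two_of_compatible fun σ ρ hσρ hρ m c H => ?_
  have hdim : coneDim σ.1 + 2 ≤ d := by
    obtain ⟨F, hF⟩ := exists_facet_ge ρ
    have h1 := coneDim_lt hσρ
    have h2 := coneDim_lt (lt_of_le_of_ne hF fun e => hρ (e ▸ F.2))
    rw [hd _ F.2] at h2
    omega
  have hex : ∀ F : 𝓜.Facet, ∃ n : ℕ, σ ≤ F.1 → c F ≠ 0 → n • 𝓜.genSum σ + m ∈ 𝓜.S F.1 := by
    intro F
    by_cases hF : σ ≤ F.1 ∧ c F ≠ 0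
    · obtain ⟨n, hn⟩ := h σ F hF.1 (by rwa [hd _ F.2]) m c H hF.2
      exact ⟨n, fun _ _ => hn⟩
    · exact ⟨0, fun h1 h2 => (hF ⟨h1, h2⟩).elim⟩
  choose n hn using hex
  set u := 𝓜.genSum σ
  have hu : u ∈ 𝓜.S σ := genSum_mem σ
  let N := ∑ F, n F
  have hN : ∀ F : 𝓜.Facet, σ ≤ F.1 → c F ≠ 0 → N • u + m ∈ 𝓜.S F.1 := by
    intro F hF hc
    obtain ⟨l, hl⟩ := Nat.exists_eq_add_of_le (show n F ≤ N from
      Finset.single_le_sum (fun _ _ => Nat.zero_le _) (Finset.mem_univ F))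
    have e : N • u + m = l • u + (n F • u + m) := by rw [hl, add_smul]; abel
    rw [e]
    exact add_mem (nsmul_mem (S_mono hF hu) l) (hn F hF hc)
  have hsucc : (N + 1) • u + m = u + (N • u + m) := by rw [succ_nsmul']; abel
  -- The additional copy of `u` forces every facet whose semigroup contains the degree to contain
  -- `σ`.
  refine ⟨N + 1, Compatible.of_imp (fun F hF => ?_) fun F F' hmF hmF' hF => ?_⟩
  · simp only [ne_eq, ite_eq_right_iff, not_forall] at hF
    obtain ⟨h1, h2⟩ := hF
    rw [hsucc]
    exact add_mem (S_mono h1 hu) (hN F h1 h2)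
  · simp only [ne_eq, ite_eq_right_iff, not_forall] at hF
    obtain ⟨h1, h2⟩ := hF
    have h3 : σ ≤ F'.1 := by
      rw [hsucc] at hmF'
      exact genSum_mem_iff.1 (mem_of_add_mem (S_mono h1 hu) (hN F h1 h2) hmF')
    rw [if_pos h1, if_pos h3]
    -- Each wall on the chain has dimension `d - 1 > dim σ`, so it is not contained in `σ` and its
    -- monomials are available to compare the two sides.
    obtain ⟨hF', h4⟩ := hconn.induction F.2 F'.2 (fun G => ∃ hG : IsFacet G, c ⟨G, hG⟩ = c F)
      ⟨F.2, rfl⟩ fun G G' hG hG' hle hcodim ⟨_, hcG⟩ => ⟨hG', by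
        have hστ : σ ≤ meet G G' := (le_meet h1 h3).trans hle
        rw [hd G hG] at hcodim
        rw [← hcG]
        refine (genSum_add_mem_of_compatible (u := (N + 1) • u) (F := ⟨G, hG⟩) H
          (fun hle' => ?_) (nsmul_mem (S_mono hστ hu) _)
          (hle ⟨latticeMap_mem hmF, latticeMap_mem hmF'⟩) (meet_le_left G G')
          (hcG ▸ h2)).2 ⟨G', hG'⟩ (meet_le_right G G')
        have := coneDim_le hle'
        omega⟩
    exact h4

variable [Module.Free ℤ M]

/-- In the domain `k[𝓜]/P_F`, that is `k[S_F]`, the fraction `χ^m` is multiplied into the ring by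
the prime of `σ`, which has height at least two. Depth two gives a multiplier outside that prime,
and one of its monomials `χ^w`, `w ∈ S_σ`, already works. -/
theorem exists_nsmul_add_mem_of_quotient {σ : 𝓜.fan.Cone} {F : 𝓜.Facet} (hF : σ ≤ F.1)
    (hdim : coneDim σ.1 + 2 ≤ coneDim F.1.1)
    (h : SatisfiesSerre 2 (𝓜.ToricFaceRing k ⧸ coneIdeal k F.1)) {m : M}
    (hm : ∀ v ∈ 𝓜.S F.1, v ∉ 𝓜.S σ → v + m ∈ 𝓜.S F.1) :
    ∃ n : ℕ, n • 𝓜.genSum σ + m ∈ 𝓜.S F.1 := by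
  have := isDomain_addMonoidAlgebra k M
  let mk := Ideal.Quotient.mk (coneIdeal k F.1)
  -- the prime ideals of the faces of `F` in the coordinate ring of the component of `F`
  let ψ : ∀ τ : 𝓜.fan.Cone, τ ≤ F.1 →
      𝓜.ToricFaceRing k ⧸ coneIdeal k F.1 →+* AddMonoidAlgebra k M :=
    fun τ hτ => Ideal.Quotient.lift _ (restrHom τ) fun a ha => coneIdeal_anti hτ ha
  have hψ : ∀ τ (hτ : τ ≤ F.1) a, mk a ∈ RingHom.ker (ψ τ hτ) ↔ a ∈ coneIdeal k τ :=
    fun _ _ _ => Iff.rfl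
  have hprime : ∀ τ (hτ : τ ≤ F.1), (RingHom.ker (ψ τ hτ)).IsPrime := fun τ hτ =>
    RingHom.ker_isPrime _
  have hlt : ∀ τ ρ (hτ : τ ≤ F.1) (hρ : ρ ≤ F.1), τ < ρ →
      RingHom.ker (ψ ρ hρ) < RingHom.ker (ψ τ hτ) := by
    intro τ ρ hτ hρ hlt
    have h1 := coneIdeal_lt (k := k) hlt
    obtain ⟨a, ha, ha'⟩ := SetLike.exists_of_lt h1
    refine SetLike.lt_iff_le_and_exists.2 ⟨fun x hx => ?_, mk a, (hψ τ hτ a).2 ha,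
      fun h => ha' ((hψ ρ hρ a).1 h)⟩
    obtain ⟨x, rfl⟩ := Ideal.Quotient.mk_surjective x
    exact h1.le hx
  have hht : 2 ≤ (RingHom.ker (ψ σ hF)).height := by
    obtain ⟨ρ, h1, h2⟩ := exists_between (lt_of_le_of_ne hF (by rintro rfl; omega)) hdim
    have := hprime σ hF
    have := hprime ρ h2.le
    have := hprime F.1 le_rfl
    exact two_le_height (hlt ρ F.1 h2.le le_rfl h2) (hlt σ ρ hF h2.le h1)
  have := hprime σ hF
  have hg := genSum_mem F.1
  have hgm : 𝓜.genSum F.1 + m ∈ 𝓜.S F.1 := hm _ hg fun h => by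
    have := coneDim_le (genSum_mem_iff.1 h)
    omega
  -- The fraction `χ^m` is written as `y / x`, with `x` the monomial of `genSum F` and `y = χ^m x`,
  -- which lies in the ring because `genSum F ∉ S_σ`.
  obtain ⟨s, hs, a, ha⟩ := exists_dvd_of_two_le_localRingDepth (RingHom.ker (ψ σ hF))
    (h.two_le_localRingDepth _ hht) (x := mk (term (𝓜.genSum F.1) 1))
    (y := mk (term (𝓜.genSum F.1 + m) 1)) (fun a ha => by
      have hne : mk (term (𝓜.genSum F.1) 1) ≠ 0 := fun h0 =>
        (term_mem_coneIdeal one_ne_zero).1 (Ideal.Quotient.eq_zero_iff_mem.1 h0) hg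
      exact (mul_eq_zero.1 ha).resolve_left hne) fun w hw => by
      obtain ⟨w, rfl⟩ := Ideal.Quotient.mk_surjective w
      replace hw := (hψ σ hF w).1 hw
      rw [coneIdeal_eq_span] at hw
      induction hw using Submodule.span_induction with
      | mem w hw =>
        obtain ⟨v, -, hvσ, rfl⟩ := hw
        by_cases hv : v ∈ 𝓜.S F.1
        · refine ⟨mk (term (v + m) 1), ?_⟩
          rw [← map_mul, ← map_mul, term_mul_term hv hgm, term_mul_term hg (hm v hv hvσ),
            add_left_comm]
        · have h0 : mk (term v 1) = 0 :=
            Ideal.Quotient.eq_zero_iff_mem.2 ((term_mem_coneIdeal one_ne_zero).2 hv)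
          exact ⟨0, by rw [mul_zero]; exact (congrArg (· * _) h0).trans (zero_mul _)⟩
      | zero => simp
      | add v w _ _ hv hw => rw [map_add, add_mul]; exact dvd_add hv hw
      | smul c w _ hw => rw [smul_eq_mul, map_mul, mul_assoc]; exact hw.mul_left _
  obtain ⟨s, rfl⟩ := Ideal.Quotient.mk_surjective s
  obtain ⟨a, rfl⟩ := Ideal.Quotient.mk_surjective a
  obtain ⟨w, hw, hsw⟩ := exists_coeff_ne_zero fun h' => hs ((hψ σ hF s).2 h')
  have key := congrArg (ψ F.1 le_rfl) ha
  rw [map_mul, map_mul] at key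
  change restrHom F.1 s * restrHom F.1 (term _ 1) = restrHom F.1 (term _ 1) * restrHom F.1 a at key
  rw [restrHom_term_of_mem hgm, restrHom_term_of_mem hg] at key
  have hwm : w + m ∈ 𝓜.S F.1 := by
    by_contra hcon
    have h1 := congrArg (fun f => f.coeff (w + (𝓜.genSum F.1 + m))) key
    simp only [AddMonoidAlgebra.coeff_mul_single_apply,
      AddMonoidAlgebra.coeff_single_mul_apply] at h1
    rw [add_neg_cancel_right, add_left_comm w, neg_add_cancel_left,
      coeff_restrHom_of_notMem _ _ hcon, mul_one, ← coeff_restrHom_eq_of_le hF s hw] at h1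
    exact hsw (by simpa using h1)
  obtain ⟨n, w', hw', hn⟩ := exists_add_eq_nsmul_genSum hw
  refine ⟨n, ?_⟩
  rw [← hn, add_comm w, add_assoc]
  exact add_mem (S_mono hF hw') hwm

open Classical in
-- Convexity moves `m` into the cone `F` by a multiple of `genSum σ`. By seminormality it remains to
-- see that the result lies in the lattice of its minimal face `τ`, which the lattice condition
-- reduces to codimension one cones `τ' ⊇ τ`.
theorem exists_nsmul_add_mem_of_seminormal
    (hsn : ∀ (σ : 𝓜.fan.Cone) (m : M), 2 • m ∈ 𝓜.S σ → 3 • m ∈ 𝓜.S σ → m ∈ 𝓜.S σ)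
    (hconn : 𝓜.fan.IsOneConnected)
    (hΛ : ∀ σ : 𝓜.fan.Cone, 0 < codim σ →
      𝓜.Λ σ = ⨅ (τ : 𝓜.fan.Cone) (_ : σ ≤ τ) (_ : codim τ = 1), 𝓜.Λ τ)
    {σ : 𝓜.fan.Cone} {F : 𝓜.Facet} (hF : σ ≤ F.1) (hdim : coneDim σ.1 + 2 ≤ coneDim F.1.1) {m : M}
    {c : 𝓜.Facet → k} (H : ∀ v ∈ 𝓜.support, v ∉ 𝓜.S σ →
      𝓜.Compatible (v + m) fun F => if v ∈ 𝓜.S F.1 then c F else 0) (hc : c F ≠ 0) :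
    ∃ n : ℕ, n • 𝓜.genSum σ + m ∈ 𝓜.S F.1 := by
  obtain ⟨d, hd⟩ := hconn.exists_coneDim_eq
  rw [hd _ F.2] at hdim
  have hm : ∀ v ∈ 𝓜.S F.1, v ∉ 𝓜.S σ → v + m ∈ 𝓜.S F.1 := fun v hv hvσ =>
    (H v ⟨F.1, hv⟩ hvσ).1 F (by simpa only [if_pos hv] using hc)
  set u := 𝓜.genSum σ
  have hu : u ∈ 𝓜.S σ := genSum_mem σ
  have huF := S_mono hF hu
  -- Otherwise some `l ≥ 0` on `F` has `l m < 0` and vanishes on a face `ρ > σ`; but `genSum ρ ∉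
  -- S_σ`, so `genSum ρ + m ∈ S_F` and `l m ≥ 0`.
  obtain ⟨f, hf, b, hb, hfb⟩ : ∃ f ∈ F.1.1, ∃ b ∈ σ.1, latticeMap M m = f - b := by
    by_contra! hcon
    obtain ⟨ρ, h1, h2, l, h3, h4, h5⟩ := exists_lt_separating hF (by rwa [hd _ F.2]) hcon
    have h6 := h3 _ (latticeMap_mem (hm _ (genSum_mem_iff.2 h2) fun h =>
      h1.not_ge (genSum_mem_iff.1 h)))
    rw [map_add, map_add, h4 _ (latticeMap_mem (genSum_mem ρ)), zero_add] at h6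
    exact h5.not_ge h6
  obtain ⟨n, hn⟩ := exists_nsmul_genSum_sub_mem hb
  have hnF : latticeMap M (n • u + m) ∈ F.1.1 := by
    rw [map_add, map_nsmul, hfb, ← add_sub_assoc, add_sub_right_comm]
    exact add_mem (hF hn) hf
  refine ⟨n + 1, ?_⟩
  have e : latticeMap M ((n + 1) • u + m) = latticeMap M (n • u + m) + latticeMap M u := by
    rw [← map_add, succ_nsmul]
    congr 1
    abel
  obtain ⟨τ, hτF, hxτ, hτ, hmem⟩ := exists_face_mem_S hsn (F := F.1) (x := (n + 1) • u + m) (by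
    rw [e]
    exact add_mem hnF (latticeMap_mem huF))
  have hστ : σ ≤ τ := le_of_latticeMap_genSum_mem <| hτ _ (latticeMap_mem huF) <| by
    rw [e, add_sub_cancel_right]
    exact hnF
  refine S_mono hτF (hmem ?_)
  by_cases hτfacet : IsFacet τ
  · obtain rfl : τ = F.1 := le_antisymm hτF (hτfacet hτF)
    have h1 := hm _ (genSum_mem F.1) fun h => by
      have := coneDim_le (genSum_mem_iff.1 h)
      rw [hd _ F.2] at this
      omega
    have e2 : (n + 1) • u + m = (n + 1) • u + (𝓜.genSum F.1 + m) - 𝓜.genSum F.1 := by abel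
    rw [e2]
    exact sub_mem (add_mem (nsmul_mem (S_le_Λ huF) _) (S_le_Λ h1)) (S_le_Λ (genSum_mem _))
  rw [hΛ τ ((codim_pos_iff τ).2 hτfacet)]
  simp only [AddSubgroup.mem_iInf]
  intro τ' hττ' hcodim
  have hdim' : d = coneDim τ'.1 + 1 := by
    rw [codim_eq hd] at hcodim
    have : d - coneDim τ'.1 = 1 := by exact_mod_cast hcodim
    omega
  obtain ⟨F', hF'⟩ := exists_facet_ge τ'
  -- The cone `τ'` need not lie in `F`. Nonvanishing of the coefficient is carried across walls
  -- containing `τ` to a facet above `τ'`, where `genSum_add_mem_of_compatible` applies to `τ'`.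
  obtain ⟨_, hcF'⟩ := hconn.induction F.2 F'.2 (fun G => ∃ hG : IsFacet G, c ⟨G, hG⟩ ≠ 0)
    ⟨F.2, hc⟩ fun G G' hG hG' hle hcodim ⟨_, hcG⟩ => ⟨hG', by
      have hτ1 : τ ≤ meet G G' := (le_meet hτF (hττ'.trans hF')).trans hle
      rw [hd G hG] at hcodim
      rw [(genSum_add_mem_of_compatible (u := (n + 1) • u) (F := ⟨G, hG⟩) H (fun hle' => by
        have := coneDim_le hle'
        omega) (nsmul_mem (S_mono (hστ.trans hτ1) hu) _) (hτ1 hxτ) (meet_le_left G G') hcG).2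
        ⟨G', hG'⟩ (meet_le_right G G')]
      exact hcG⟩
  have h1 := (genSum_add_mem_of_compatible (u := (n + 1) • u) (F := F') H (τ := τ') (fun hle' => by
    have := coneDim_le hle'
    omega) (nsmul_mem (S_mono (hστ.trans hττ') hu) _) (hττ' hxτ) hF' hcF').1
  have h2 := sub_mem (S_le_Λ h1) (S_le_Λ (genSum_mem τ'))
  rwa [add_sub_cancel_left] at h2

end ToricFaceRing

end MonoidalComplex

end

/-! ### Both corollaries. -/

theorem corollary4p11 {k : Type*} [Field k] {M : Type*} [AddCommGroup M] [Module.Free ℤ M]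
    [Module.Finite ℤ M] (𝓜 : MonoidalComplex M) :
    (IsSeminormalRing (𝓜.ToricFaceRing k) →
      (SatisfiesSerre 2 (𝓜.ToricFaceRing k) ↔
        𝓜.fan.IsOneConnected ∧
        ∀ σ : 𝓜.fan.Cone, 0 < RationalFan.codim σ →
          𝓜.Λ σ = ⨅ (τ : 𝓜.fan.Cone) (_ : σ ≤ τ) (_ : RationalFan.codim τ = 1), 𝓜.Λ τ)) ∧
    ((∀ 𝔭 ∈ minimalPrimes (𝓜.ToricFaceRing k), SatisfiesSerre 2 (𝓜.ToricFaceRing k ⧸ 𝔭)) →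
      (SatisfiesSerre 2 (𝓜.ToricFaceRing k) ↔ 𝓜.fan.IsOneConnected)) := by
  open MonoidalComplex.ToricFaceRing in
  refine ⟨fun h => ⟨fun hS => ⟨isOneConnected_of_satisfiesSerre hS, fun σ hσ =>
      Λ_eq_iInf_of_satisfiesSerre hS (mem_S_of_isSeminormalRing h) σ
        ((RationalFan.codim_pos_iff σ).1 hσ)⟩, fun ⟨hconn, hΛ⟩ =>
      satisfiesSerre_two_of_isOneConnected hconn fun σ F hF hdim m c H hc =>
        exists_nsmul_add_mem_of_seminormal (mem_S_of_isSeminormalRing h) hconn hΛ hF hdim H hc⟩,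
    fun h => ⟨isOneConnected_of_satisfiesSerre, fun hconn =>
      satisfiesSerre_two_of_isOneConnected hconn fun σ F hF hdim m c H hc =>
        exists_nsmul_add_mem_of_quotient hF hdim (h _ (coneIdeal_mem_minimalPrimes F))
          fun v hv hvσ => (H v ⟨F.1, hv⟩ hvσ).1 F (by simpa only [if_pos hv] using hc)⟩⟩
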